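/- Let $g:[0,1]\to[0,\infty)$ be piecewise $C^2$ on $[0,1]$: $[0,1]$ can be partitioned into finitely many subintervals on whose interiors $g$ is $C^2$, and $g,g',g''$ have finite one-sided limits at all the endpoints of these subintervals. Assume that for some $\varepsilon>0$ we have $g(x)\ge\varepsilon$ for all $x\in[1-\varepsilon,1]\cap[0,1]$. Put $$C(\theta)=\int_0^1(e^{\theta x}-1)\,g(x)\,dx\qquad(\theta\in\mathbb R),$$ and let $T$ be a real random variable with $\log \mathbb E\,e^{\theta T}=C(\theta)$ for all real $\theta$. Then the distribution of $T$ is the sum of an atom at $0$ and an absolutely continuous part with a (defective) density $f\ge 0$ that can be chosen continuous on $(1,\infty)$; let $f$ be such a version. For every $u>0$ there is a unique real $\beta=\beta(u)$ with $C'(\beta)=u$; let $\sigma_\beta=\sqrt{C''(\beta)}$. Then, as $u\to\infty$, $$f(u)=\frac{e^{C(\beta)-u\beta}}{\sqrt{2\pi}\,\sigma_\beta}\left(1+O\left(\frac1u\right)\right),$$ $$\mathbb P(T\ge u)=\frac1\beta\,\frac{e^{C(\beta)-u\beta}}{\sqrt{2\pi}\,\sigma_\beta}\left(1+O\left(\frac1{\sqrt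 u}\right)\right),$$ and hence $$\mathbb P(T\ge u)=\frac{f(u)}{\beta}\left(1+O\left(\frac1{\sqrt u}\right)\right).$$ -/

import Mathlib

open MeasureTheory ProbabilityTheory Filter Topology Set Asymptotics

/-- `g` is piecewise `C^k` on `[a, b]`: there is a finite partition
`a = p 0 < p 1 < ⋯ < p n = b` such that `g` is `C^k` on each open subinterval, and `g` and its
derivatives of order `≤ k` have finite one-sided limits at both ends of each subinterval.
(The values of `g` at the partition points are unrestricted.) -/
def PiecewiseContDiff (k : ℕ) (g : ℝ → ℝ) (a b : ℝ) : Prop :=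
  ∃ (n : ℕ) (p : Fin (n + 1) → ℝ), StrictMono p ∧ p 0 = a ∧ p (Fin.last n) = b ∧
    ∀ i : Fin n,
      ContDiffOn ℝ (k : WithTop ℕ∞) g (Ioo (p i.castSucc) (p i.succ)) ∧
      ∀ j ≤ k,
        (∃ l : ℝ, Tendsto (iteratedDeriv j g) (𝓝[>] (p i.castSucc)) (𝓝 l)) ∧
        (∃ l : ℝ, Tendsto (iteratedDeriv j g) (𝓝[<] (p i.succ)) (𝓝 l))

/-- The function `C(θ) = ∫₀¹ (e^{θ x} - 1) g(x) dx`. -/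
noncomputable def levyCumulant (g : ℝ → ℝ) (θ : ℝ) : ℝ :=
  ∫ x in (0 : ℝ)..1, (Real.exp (θ * x) - 1) * g x

/-- The random variable `T` has the infinitely divisible distribution with Lévy measure
`g(x) dx` on `(0, 1]`: all exponential moments are finite and
`log E e^{θ T} = C(θ)` for every real `θ`. -/
def HasLevyDensity {Ω : Type*} [MeasurableSpace Ω] (T : Ω → ℝ) (P : Measure Ω)
    (g : ℝ → ℝ) : Prop :=
  ∀ θ : ℝ, Integrable (fun ω => Real.exp (θ * T ω)) P ∧ cgf T P θ = levyCumulant g θ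

/-- `f` is the defective density of `T`: the law of `T` is its atom at `0` plus `f(x) dx`.
The density is taken in the version that is continuous on `(1, ∞)`, so that `f(u)` is determined
by the law of `T` for every `u > 1`. -/
structure IsDefectiveDensity {Ω : Type*} [MeasurableSpace Ω] (T : Ω → ℝ) (P : Measure Ω)
    (f : ℝ → ℝ) : Prop where
  measurable : Measurable f
  nonneg : ∀ x, 0 ≤ f x
  law_eq : P.map T = (P.map T {0}) • Measure.dirac (0 : ℝ) +
    volume.withDensity (fun x => ENNReal.ofReal (f x))
  continuousOn : ContinuousOn f (Ioi 1)

/-- `σ_β = √(C''(β))`. -/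
noncomputable def tiltedSigma (g : ℝ → ℝ) (β : ℝ) : ℝ :=
  Real.sqrt (iteratedDeriv 2 (levyCumulant g) β)

/-- The main term `e^{C(β) - u β} / (√(2π) σ_β)`. -/
noncomputable def saddleTerm (g : ℝ → ℝ) (β u : ℝ) : ℝ :=
  Real.exp (levyCumulant g β - u * β) / (Real.sqrt (2 * Real.pi) * tiltedSigma g β)

/-- `F(u) = M(u) (1 + O(e(u)))` as `u → ∞`. -/
def EqMulOneAddBigO (F M e : ℝ → ℝ) : Prop :=
  ∃ r : ℝ → ℝ, r =O[atTop] e ∧ ∀ᶠ u in atTop, F u = M u * (1 + r u)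

/-! Let `ν` be `g(x) dx` on `(0, 1)`, a finite measure, `N(z) = ∫ e^{zx} ν(dx)`, and `m_n(β) = ∫ x^n
e^{βx} ν(dx)`. Then `C(θ) = N(θ) - N(0)`, so `T` is compound Poisson and `E e^{zT} = e^{N(z) -
N(0)}` for complex `z`. With `p = e^{-N(0)}`, the transform splits into `p` (the atom at `0`), `pN`
(a single jump, absent beyond `1`) and `p(e^N - 1 - N)`. The last is `O(|N|^2)` on a vertical line,
hence integrable there by Plancherel. Fourier inversion therefore gives, for `u > 1` and any `β`,
`e^{βu} f(u) = (p/2π) ∫ e^{-iut} (e^N - 1 - N)(β + it) dt` (`exp_mul_eq_saddleIntegral`).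

Take `β` with `m_1(β) = C'(β) = u`. For `|t| ≤ 1` the phase cancels the linear Taylor term and the
exponent is `m_0 - m_2 t²/2 - i m_3 t³/6 + O(m_4 t⁴)`. Since `x < 1`, the moments `m_2, m_3, m_4`
are at most `u`, while `m_2 ≥ u/4` for large `β`. The cubic term is odd and integrates to zero, so
the relative error is `O(1/u)` and not `O(1/√u)`. For `|t| ≥ 1`, the bound `g ≥ ε` near `1` gives
`Re N ≤ m_0 - c e^β/β³`, a saving that beats every power of `u ≤ ν(ℝ) e^β`. Together these give
`saddleIntegral_asymptotics`.

For the tail, `P(T ≥ u) = ∫_0^∞ f(u + v) dv` is treated with `β` kept fixed. Moving the point by `v`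
costs a factor `|e^{-ivt} - 1| ≤ v|t|`, so `e^{βv} f(u + v)` differs from `f(u)` by a relative
`O(v/√u + 1/u)`, and integration against `e^{-βv}` gives `f(u)/β` (`saddle_bounds`).

The density exists by size-biasing: differentiating the Laplace transform shows that `x μ(dx)` is
the convolution of `μ` with `x g(x) dx`, so dividing by `x` yields an explicit density. -/

/-! ### Elementary inequalities. -/

/-- The square lets an L² bound on `N` control the remainder; having only `z.re` in the exponential
preserves the saving in `Re N` away from the real axis. -/
theorem norm_exp_sub_one_sub_id_le_sq (z : ℂ) :
    ‖Complex.exp z - 1 - z‖ ≤ ‖z‖ ^ 2 * (Real.exp z.re + 2) := by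
  rcases le_total ‖z‖ 1 with h | h
  · refine (Complex.norm_exp_sub_one_sub_id_le h).trans ?_
    have := Real.exp_pos z.re
    nlinarith [sq_nonneg ‖z‖]
  · have h1 : ‖Complex.exp z - 1 - z‖ ≤ Real.exp z.re + 1 + ‖z‖ := by
      refine (norm_sub_le _ _).trans (add_le_add ((norm_sub_le _ _).trans ?_) le_rfl)
      rw [Complex.norm_exp]; simp
    have h3 : (1 : ℝ) ≤ ‖z‖ ^ 2 := one_le_pow₀ h
    have h4 : ‖z‖ ≤ ‖z‖ ^ 2 := by nlinarith
    nlinarith [Real.exp_pos z.re]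

theorem norm_exp_sub_exp_le {z w : ℂ} {r : ℝ} (hz : z.re ≤ r) (hw : w.re ≤ r) :
    ‖Complex.exp z - Complex.exp w‖ ≤ Real.exp r * ‖z - w‖ := by
  refine Convex.norm_image_sub_le_of_norm_deriv_le (𝕜 := ℂ) (s := {z : ℂ | z.re ≤ r})
    (fun x _ => Complex.differentiable_exp x) (fun x hx => ?_) (convex_halfSpace_re_le r) hw hz
  rw [Complex.deriv_exp, Complex.norm_exp]
  exact Real.exp_le_exp.2 hx

theorem one_fifth_sq_le_one_sub_cos {y : ℝ} (hy : |y| ≤ 1) : y ^ 2 / 5 ≤ 1 - Real.cos y := by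
  have h := Real.cos_bound hy
  have h1 := (abs_le.1 h).2
  have h2 : |y| ^ 4 ≤ y ^ 2 := by
    rw [← sq_abs y]; exact pow_le_pow_of_le_one (abs_nonneg _) hy (by norm_num)
  nlinarith [sq_nonneg y]

/-! ### Tilted moments and the transform on a vertical line. -/

section Moments

variable {ν : Measure ℝ}

/-- The `n`-th moment of the exponentially tilted measure `e^{βx} ν(dx)`. -/
noncomputable def tiltedMoment (ν : Measure ℝ) (n : ℕ) (β : ℝ) : ℝ :=
  ∫ x, x ^ n * Real.exp (β * x) ∂ν

variable [IsFiniteMeasure ν]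

theorem integrable_of_bounded_on_unit (hν : ∀ᵐ x ∂ν, x ∈ Ioo (0 : ℝ) 1) {E : Type*}
    [NormedAddCommGroup E] {f : ℝ → E} (hf : AEStronglyMeasurable f ν) (C : ℝ)
    (h : ∀ x ∈ Ioo (0 : ℝ) 1, ‖f x‖ ≤ C) : Integrable f ν :=
  Integrable.of_bound hf C (hν.mono h)

theorem integrable_of_continuous_unit (hν : ∀ᵐ x ∂ν, x ∈ Ioo (0 : ℝ) 1) {E : Type*}
    [NormedAddCommGroup E] [SecondCountableTopologyEither ℝ E]
    {f : ℝ → E} (hf : Continuous f) : Integrable f ν := by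
  obtain ⟨C, hC⟩ := (isCompact_Icc (a := (0 : ℝ)) (b := 1)).exists_bound_of_continuousOn
    hf.continuousOn
  exact integrable_of_bounded_on_unit hν hf.aestronglyMeasurable C
    fun x hx => hC x (Ioo_subset_Icc_self hx)

omit [IsFiniteMeasure ν] in
theorem tiltedMoment_nonneg (hν : ∀ᵐ x ∂ν, x ∈ Ioo (0 : ℝ) 1) (n : ℕ) (β : ℝ) :
    0 ≤ tiltedMoment ν n β :=
  integral_nonneg_of_ae (hν.mono fun _ hx => mul_nonneg (pow_nonneg hx.1.le _) (Real.exp_pos _).le)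

theorem integrable_tilted (hν : ∀ᵐ x ∂ν, x ∈ Ioo (0 : ℝ) 1) (n : ℕ) (β : ℝ) :
    Integrable (fun x => x ^ n * Real.exp (β * x)) ν :=
  integrable_of_continuous_unit hν (by fun_prop)

theorem tiltedMoment_antitone (hν : ∀ᵐ x ∂ν, x ∈ Ioo (0 : ℝ) 1) (β : ℝ) :
    Antitone fun n => tiltedMoment ν n β := by
  intro n m hnm
  refine integral_mono_ae (integrable_tilted hν _ _) (integrable_tilted hν _ _)
    (hν.mono fun x hx => ?_)
  exact mul_le_mul_of_nonneg_right (pow_le_pow_of_le_one hx.1.le hx.2.le hnm) (Real.exp_pos _).le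

/-- On `x ≥ 1/2` one has `x² ≥ x/2`; on `x ≤ 1/2` the tilt is at most `e^{β/2}`, negligible against
a first moment of order `e^β/β`. -/
theorem tiltedMoment_one_le_two (hν : ∀ᵐ x ∂ν, x ∈ Ioo (0 : ℝ) 1) {β : ℝ} (hβ : 0 ≤ β) :
    tiltedMoment ν 1 β / 2 - ν.real univ * Real.exp (β / 2) ≤ tiltedMoment ν 2 β := by
  have h : ∫ x, (x ^ 1 * Real.exp (β * x) / 2 - Real.exp (β / 2)) ∂ν ≤ tiltedMoment ν 2 β := by
    refine integral_mono_ae (((integrable_tilted hν _ _).div_const _).sub (integrable_const _))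
      (integrable_tilted hν _ _) (hν.mono fun x hx => ?_)
    have h0 := Real.exp_pos (β * x)
    have h1 := Real.exp_pos (β / 2)
    rcases le_total x (1 / 2) with hx2 | hx2
    · have : Real.exp (β * x) ≤ Real.exp (β / 2) := Real.exp_le_exp.2 (by nlinarith)
      dsimp only
      nlinarith [sq_nonneg (x - 1), mul_nonneg h0.le hx.1.le, mul_nonneg h0.le (sq_nonneg x),
        mul_nonneg h0.le (sub_nonneg.2 hx2)]
    · dsimp only
      nlinarith [mul_nonneg (mul_nonneg h0.le hx.1.le) (sub_nonneg.2 hx2)]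
  rw [integral_sub ((integrable_tilted hν _ _).div_const _) (integrable_const _),
    integral_div] at h
  simpa [tiltedMoment] using h

theorem tiltedMoment_zero_le (hν : ∀ᵐ x ∂ν, x ∈ Ioo (0 : ℝ) 1) {β : ℝ} (hβ : 0 ≤ β) :
    tiltedMoment ν 0 β ≤ ν.real univ * Real.exp β := by
  have h : tiltedMoment ν 0 β ≤ ∫ _, Real.exp β ∂ν := by
    refine integral_mono_ae (integrable_tilted hν _ _) (integrable_const _)
      (hν.mono fun x hx => ?_)
    simpa using mul_le_of_le_one_right hβ hx.2.le
  simpa using h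

theorem integrable_cexp (hν : ∀ᵐ x ∂ν, x ∈ Ioo (0 : ℝ) 1) (z : ℂ) :
    Integrable (fun x : ℝ => Complex.exp (z * x)) ν :=
  integrable_of_continuous_unit hν (by fun_prop)

omit [IsFiniteMeasure ν] in
theorem complexMGF_id_ofReal (β : ℝ) : complexMGF id ν β = tiltedMoment ν 0 β := by
  rw [complexMGF_ofReal]; simp [mgf, tiltedMoment]

theorem complexMGF_taylor (hν : ∀ᵐ x ∂ν, x ∈ Ioo (0 : ℝ) 1) (β : ℝ) {t : ℝ} (ht : |t| ≤ 1) :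
    ‖complexMGF id ν (β + t * Complex.I) - tiltedMoment ν 0 β -
      (Complex.I * t * tiltedMoment ν 1 β - t ^ 2 * tiltedMoment ν 2 β / 2 -
        Complex.I * t ^ 3 * tiltedMoment ν 3 β / 6)‖ ≤ tiltedMoment ν 4 β * t ^ 4 := by
  have hc (n : ℕ) : Integrable (fun x : ℝ => ((x ^ n * Real.exp (β * x) : ℝ) : ℂ)) ν :=
    (integrable_tilted hν n β).ofReal
  have hm (n : ℕ) : (tiltedMoment ν n β : ℂ) = ∫ x, ((x ^ n * Real.exp (β * x) : ℝ) : ℂ) ∂ν :=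
    integral_ofReal.symm
  have key : complexMGF id ν (β + t * Complex.I) - tiltedMoment ν 0 β -
      (Complex.I * t * tiltedMoment ν 1 β - t ^ 2 * tiltedMoment ν 2 β / 2 -
        Complex.I * t ^ 3 * tiltedMoment ν 3 β / 6) =
      ∫ x, (Complex.exp ((β + t * Complex.I) * x) - ((x ^ 0 * Real.exp (β * x) : ℝ) : ℂ) -
        (Complex.I * t * ((x ^ 1 * Real.exp (β * x) : ℝ) : ℂ) -
          t ^ 2 / 2 * ((x ^ 2 * Real.exp (β * x) : ℝ) : ℂ) -
        Complex.I * t ^ 3 / 6 * ((x ^ 3 * Real.exp (β * x) : ℝ) : ℂ))) ∂ν := by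
    have h1 := (hc 1).const_mul (Complex.I * t)
    have h2 := (hc 2).const_mul ((t : ℂ) ^ 2 / 2)
    have h3 := (hc 3).const_mul (Complex.I * t ^ 3 / 6)
    have h0 := integrable_cexp hν (β + t * Complex.I)
    rw [integral_sub, integral_sub h0 (hc 0), integral_sub (by exact h1.sub h2) h3,
      integral_sub h1 h2, integral_const_mul, integral_const_mul, integral_const_mul,
      ← hm, ← hm, ← hm, ← hm]
    · simp only [complexMGF, id]
      ring
    · exact h0.sub (hc 0)
    · exact (h1.sub h2).sub h3
  rw [key, tiltedMoment, ← integral_mul_const]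
  refine norm_integral_le_of_norm_le ((integrable_tilted hν 4 β).mul_const _)
    (hν.mono fun x hx => ?_)
  have hn : ‖Complex.I * t * x‖ = |t| * x := by simp [abs_of_pos hx.1]
  have hb := Complex.exp_bound (x := Complex.I * t * x) (n := 4)
    (by rw [hn]; exact mul_le_one₀ ht hx.1.le hx.2.le) (by norm_num)
  have e : Complex.exp ((β + t * Complex.I) * x) - ((x ^ 0 * Real.exp (β * x) : ℝ) : ℂ) -
        (Complex.I * t * ((x ^ 1 * Real.exp (β * x) : ℝ) : ℂ) -
          t ^ 2 / 2 * ((x ^ 2 * Real.exp (β * x) : ℝ) : ℂ) -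
        Complex.I * t ^ 3 / 6 * ((x ^ 3 * Real.exp (β * x) : ℝ) : ℂ)) =
      (Real.exp (β * x) : ℝ) * (Complex.exp (Complex.I * t * x) -
        ∑ m ∈ Finset.range 4, (Complex.I * t * x) ^ m / m.factorial) := by
    have : Complex.exp ((β + t * Complex.I) * x) =
        (Real.exp (β * x) : ℝ) * Complex.exp (Complex.I * t * x) := by
      rw [Complex.ofReal_exp, ← Complex.exp_add]; congr 1; push_cast; ring
    rw [this]
    simp only [Finset.sum_range_succ, Finset.sum_range_zero, Nat.factorial]
    push_cast
    linear_combination Complex.exp (β * x) * ((t : ℂ) ^ 2 * x ^ 2 / 2 +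
      Complex.I * t ^ 3 * x ^ 3 / 6) * Complex.I_sq
  rw [e, norm_mul, Complex.norm_real, Real.norm_of_nonneg (Real.exp_pos _).le]
  calc _ ≤ Real.exp (β * x) * (|t| * x) ^ 4 := by
        refine mul_le_mul_of_nonneg_left (hb.trans ?_) (Real.exp_pos _).le
        rw [hn]
        refine mul_le_of_le_one_right (by have := hx.1; positivity) ?_
        -- The constant in `Complex.exp_bound` for `n = 4` is `5/96`, below `1`.
        norm_num [Nat.factorial]
    _ = _ := by rw [mul_pow, ← abs_pow, abs_of_nonneg (by positivity : 0 ≤ t ^ 4)]; ring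

theorem re_complexMGF (hν : ∀ᵐ x ∂ν, x ∈ Ioo (0 : ℝ) 1) (β t : ℝ) :
    (complexMGF id ν (β + t * Complex.I)).re = ∫ x, Real.exp (β * x) * Real.cos (t * x) ∂ν := by
  have h := integral_re (𝕜 := ℂ) (integrable_cexp hν (β + t * Complex.I))
  simp only [RCLike.re_eq_complex_re] at h
  rw [complexMGF]
  simp only [id]
  rw [← h]
  refine integral_congr_ae (.of_forall fun x => ?_)
  simp [Complex.exp_re]

/-- Integrating `1 - cos y ≥ y²/5` gives Gaussian decay of the modulus on all of `|t| ≤ 1`, so the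
whole interval can serve as the central region. -/
theorem re_complexMGF_le (hν : ∀ᵐ x ∂ν, x ∈ Ioo (0 : ℝ) 1) (β : ℝ) {t : ℝ} (ht : |t| ≤ 1) :
    (complexMGF id ν (β + t * Complex.I)).re ≤
      tiltedMoment ν 0 β - tiltedMoment ν 2 β * t ^ 2 / 5 := by
  rw [re_complexMGF hν, tiltedMoment, tiltedMoment, ← integral_mul_const, ← integral_div,
    ← integral_sub (integrable_tilted hν 0 β) (((integrable_tilted hν 2 β).mul_const _).div_const _)]
  refine integral_mono_ae (integrable_of_continuous_unit hν (by fun_prop))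
    ((integrable_tilted hν 0 β).sub (((integrable_tilted hν 2 β).mul_const _).div_const _))
    (hν.mono fun x hx => ?_)
  have h := one_fifth_sq_le_one_sub_cos (y := t * x)
    (by rw [abs_mul, abs_of_pos hx.1]; exact mul_le_one₀ ht hx.1.le hx.2.le)
  have := mul_le_mul_of_nonneg_left h (Real.exp_pos (β * x)).le
  dsimp only
  linarith

end Moments

/-! ### The central Gaussian integral with its cubic correction. -/

/-- Half of the Gaussian decay absorbs the polynomial. With `y = s t²` one has `u t² ≤ 4y`, `y² ≤
200 e^{y/10}` and `y³ ≤ 6000 e^{y/10}`, and `16·200 + 64·6000 ≤ 400000`. -/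
theorem exp_neg_mul_poly_le {u s t : ℝ} (hu : 0 < u) (hs : u / 4 ≤ s) :
    Real.exp (-(s * t ^ 2) / 5) * (u * t ^ 4 + u ^ 2 * t ^ 6) ≤
      400000 / u * Real.exp (-(s * t ^ 2) / 10) := by
  have hs0 : 0 < s := by linarith
  set y := s * t ^ 2 with hy
  have hy0 : 0 ≤ y := by positivity
  have h2 := Real.pow_div_factorial_le_exp (y / 10) (by positivity) 2
  have h3 := Real.pow_div_factorial_le_exp (y / 10) (by positivity) 3
  norm_num [Nat.factorial] at h2 h3
  have hut : u * t ^ 2 ≤ 4 * y := by rw [hy]; nlinarith [sq_nonneg t]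
  have e1 : u * t ^ 4 ≤ 16 * y ^ 2 / u := by
    rw [le_div_iff₀ hu]
    calc _ = (u * t ^ 2) ^ 2 := by ring
      _ ≤ (4 * y) ^ 2 := pow_le_pow_left₀ (by positivity) hut 2
      _ = _ := by ring
  have e2 : u ^ 2 * t ^ 6 ≤ 64 * y ^ 3 / u := by
    rw [le_div_iff₀ hu]
    calc _ = (u * t ^ 2) ^ 3 := by ring
      _ ≤ (4 * y) ^ 3 := pow_le_pow_left₀ (by positivity) hut 3
      _ = _ := by ring
  have h4 : u * t ^ 4 + u ^ 2 * t ^ 6 ≤ 400000 / u * Real.exp (y / 10) := by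
    calc _ ≤ 16 * y ^ 2 / u + 64 * y ^ 3 / u := add_le_add e1 e2
      _ = (16 * y ^ 2 + 64 * y ^ 3) / u := by ring
      _ ≤ 400000 * Real.exp (y / 10) / u := by
        gcongr
        nlinarith [Real.exp_pos (y / 10)]
      _ = _ := by ring
  calc _ ≤ Real.exp (-y / 5) * (400000 / u * Real.exp (y / 10)) := by gcongr
    _ = 400000 / u * (Real.exp (-y / 5) * Real.exp (y / 10)) := by ring
    _ = _ := by rw [← Real.exp_add]; ring_nf

/-- The cubic term is taken out of the exponent to first order. This costs its square, `u² t⁶`,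
beside the quartic Taylor error `u t⁴`. For `|t| > 1` the comparison function itself is bounded by
the same polynomial. -/
theorem norm_exp_sub_edgeworth_le {u s m₃ m₄ t : ℝ} {w : ℂ} (hu : 1 ≤ u) (hs : u / 4 ≤ s)
    (h₃ : 0 ≤ m₃) (h₃' : m₃ ≤ u) (h₄ : m₄ ≤ u)
    (hw : |t| ≤ 1 → ‖w - (-(s * t ^ 2 / 2 : ℝ) - (m₃ * t ^ 3 / 6 : ℝ) * Complex.I)‖ ≤ m₄ * t ^ 4)
    (hre : |t| ≤ 1 → w.re ≤ -(s * t ^ 2) / 5) :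
    ‖(if |t| ≤ 1 then Complex.exp w else 0) - Complex.exp (-(s * t ^ 2 / 2 : ℝ)) *
      (1 - (m₃ * t ^ 3 / 6 : ℝ) * Complex.I)‖ ≤ 400000 / u * Real.exp (-(s * t ^ 2) / 10) := by
  have hs0 : 0 < s := by linarith
  have hy0 : 0 ≤ s * t ^ 2 := by positivity
  refine le_trans ?_ (exp_neg_mul_poly_le (by linarith) hs)
  have ha : Real.exp (-(s * t ^ 2 / 2)) ≤ Real.exp (-(s * t ^ 2) / 5) :=
    Real.exp_le_exp.2 (by linarith)
  have hna : ‖Complex.exp (-(s * t ^ 2 / 2 : ℝ))‖ = Real.exp (-(s * t ^ 2 / 2)) := by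
    rw [Complex.norm_exp, Complex.neg_re, Complex.ofReal_re]
  have hb : ‖((m₃ * t ^ 3 / 6 : ℝ) : ℂ) * Complex.I‖ ≤ u * |t| ^ 3 / 6 := by
    rw [norm_mul, Complex.norm_I, mul_one, Complex.norm_real, Real.norm_eq_abs, abs_div, abs_mul,
      abs_of_nonneg h₃, abs_pow, abs_of_pos (by norm_num : (0 : ℝ) < 6)]
    gcongr
  split_ifs with ht
  · have h1 := norm_exp_sub_exp_le (w := -(s * t ^ 2 / 2 : ℝ) - (m₃ * t ^ 3 / 6 : ℝ) * Complex.I)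
      (hre ht) (by
        rw [Complex.sub_re, Complex.neg_re, Complex.ofReal_re, Complex.re_ofReal_mul, Complex.I_re]
        linarith)
    have h2 : ‖Complex.exp (-(s * t ^ 2 / 2 : ℝ) - (m₃ * t ^ 3 / 6 : ℝ) * Complex.I) -
        Complex.exp (-(s * t ^ 2 / 2 : ℝ)) * (1 - (m₃ * t ^ 3 / 6 : ℝ) * Complex.I)‖ ≤
        Real.exp (-(s * t ^ 2) / 5) * (u ^ 2 * t ^ 6) := by
      have h := norm_exp_sub_one_sub_id_le_sq (-(((m₃ * t ^ 3 / 6 : ℝ) : ℂ) * Complex.I))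
      have hre0 : (-(((m₃ * t ^ 3 / 6 : ℝ) : ℂ) * Complex.I)).re = 0 := by
        rw [Complex.neg_re, Complex.re_ofReal_mul, Complex.I_re, mul_zero, neg_zero]
      rw [hre0, norm_neg, Real.exp_zero] at h
      rw [sub_eq_add_neg (-((s * t ^ 2 / 2 : ℝ) : ℂ)), Complex.exp_add, ← mul_sub, norm_mul, hna]
      refine mul_le_mul ha ?_ (norm_nonneg _) (Real.exp_pos _).le
      calc _ = ‖Complex.exp (-(((m₃ * t ^ 3 / 6 : ℝ) : ℂ) * Complex.I)) - 1 -
            (-(((m₃ * t ^ 3 / 6 : ℝ) : ℂ) * Complex.I))‖ := by congr 1; ring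
        _ ≤ _ := h
        _ ≤ (u * |t| ^ 3 / 6) ^ 2 * (1 + 2) := by gcongr
        _ = u ^ 2 * |t| ^ 6 / 12 := by ring
        _ ≤ u ^ 2 * t ^ 6 := by
          rw [(by decide : Even 6).pow_abs]
          linarith [(by positivity : 0 ≤ u ^ 2 * t ^ 6)]
    have h3 : ‖Complex.exp w -
        Complex.exp (-(s * t ^ 2 / 2 : ℝ) - (m₃ * t ^ 3 / 6 : ℝ) * Complex.I)‖ ≤
        Real.exp (-(s * t ^ 2) / 5) * (u * t ^ 4) := by
      refine h1.trans (mul_le_mul_of_nonneg_left ((hw ht).trans ?_) (Real.exp_pos _).le)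
      gcongr
    calc _ ≤ _ := norm_sub_le_norm_sub_add_norm_sub _
          (Complex.exp (-(s * t ^ 2 / 2 : ℝ) - (m₃ * t ^ 3 / 6 : ℝ) * Complex.I)) _
      _ ≤ _ := add_le_add h3 h2
      _ = _ := by ring
  · have ht1 : 1 ≤ |t| := (not_le.1 ht).le
    rw [zero_sub, norm_neg, norm_mul, hna]
    refine mul_le_mul ha ?_ (norm_nonneg _) (Real.exp_pos _).le
    have h6 : (1 : ℝ) ≤ t ^ 6 := by
      rw [← (by decide : Even 6).pow_abs]; exact one_le_pow₀ ht1
    have h34 : |t| ^ 3 ≤ t ^ 4 := by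
      rw [← (by decide : Even 4).pow_abs]; exact pow_le_pow_right₀ ht1 (by norm_num)
    have hu2 : 1 ≤ u ^ 2 := one_le_pow₀ hu
    calc _ ≤ 1 + u * |t| ^ 3 / 6 := by
          refine (norm_sub_le _ _).trans ?_
          rw [norm_one]; gcongr
      _ ≤ u ^ 2 * t ^ 6 + u * t ^ 4 := by
          refine add_le_add (by nlinarith) ?_
          have : u * |t| ^ 3 ≤ u * t ^ 4 := by gcongr
          linarith [(by positivity : 0 ≤ u * |t| ^ 3)]
      _ = _ := by ring

theorem integral_eq_zero_of_odd {f : ℝ → ℂ} (hf : ∀ x, f (-x) = -f x) : ∫ x, f x = 0 := by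
  have h := integral_neg_eq_self f volume
  simp only [hf, integral_neg] at h
  linear_combination (-1 / 2 : ℂ) * h

/-- The cubic correction is odd and drops out of the integral, which is why no error of relative
order `1/√u` appears in the density. -/
theorem integral_edgeworth {s : ℝ} (hs : 0 < s) (m : ℝ) :
    Integrable (fun t : ℝ => Complex.exp (-(s * t ^ 2 / 2 : ℝ)) *
        (1 - (m * t ^ 3 / 6 : ℝ) * Complex.I)) ∧
    ∫ t : ℝ, Complex.exp (-(s * t ^ 2 / 2 : ℝ)) * (1 - (m * t ^ 3 / 6 : ℝ) * Complex.I) =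
      (Real.sqrt (2 * Real.pi / s) : ℝ) := by
  have e (t : ℝ) : Complex.exp (-(s * t ^ 2 / 2 : ℝ)) * (1 - (m * t ^ 3 / 6 : ℝ) * Complex.I) =
      ((Real.exp (-(s / 2) * t ^ 2) : ℝ) : ℂ) -
        ((t ^ 3 * Real.exp (-(s / 2) * t ^ 2) : ℝ) : ℂ) * (m / 6 * Complex.I) := by
    rw [← Complex.ofReal_neg, ← Complex.ofReal_exp,
      (by ring : -(s * t ^ 2 / 2) = -(s / 2) * t ^ 2)]
    push_cast; ring
  simp_rw [e]
  have i1 : Integrable (fun t : ℝ => ((Real.exp (-(s / 2) * t ^ 2) : ℝ) : ℂ)) :=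
    (integrable_exp_neg_mul_sq (half_pos hs)).ofReal
  have i2 : Integrable (fun t : ℝ => t ^ 3 * Real.exp (-(s / 2) * t ^ 2)) := by
    have := integrable_rpow_mul_exp_neg_mul_sq (half_pos hs) (s := 3) (by norm_num)
    exact_mod_cast this
  have i3 : Integrable (fun t : ℝ => ((t ^ 3 * Real.exp (-(s / 2) * t ^ 2) : ℝ) : ℂ) *
      (m / 6 * Complex.I)) := i2.ofReal.mul_const _
  refine ⟨i1.sub i3, ?_⟩
  rw [integral_sub i1 i3]
  have z : ∫ t : ℝ, ((t ^ 3 * Real.exp (-(s / 2) * t ^ 2) : ℝ) : ℂ) * (m / 6 * Complex.I) = 0 :=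
    integral_eq_zero_of_odd fun x => by
      rw [(by decide : Odd 3).neg_pow, neg_sq]; push_cast; ring
  rw [z, sub_zero]
  refine (integral_ofReal (𝕜 := ℂ) (μ := volume)
    (f := fun t : ℝ => Real.exp (-(s / 2) * t ^ 2))).trans ?_
  rw [integral_gaussian, (by field_simp : Real.pi / (s / 2) = 2 * Real.pi / s)]
  rfl

theorem norm_integral_central_sub_le {u s m₃ m₄ : ℝ} {w : ℝ → ℂ} (hu : 1 ≤ u) (hs : u / 4 ≤ s)
    (h₃ : 0 ≤ m₃) (h₃' : m₃ ≤ u) (h₄ : m₄ ≤ u) (hwc : Continuous w)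
    (hw : ∀ t, |t| ≤ 1 →
      ‖w t - (-(s * t ^ 2 / 2 : ℝ) - (m₃ * t ^ 3 / 6 : ℝ) * Complex.I)‖ ≤ m₄ * t ^ 4)
    (hre : ∀ t, |t| ≤ 1 → (w t).re ≤ -(s * t ^ 2) / 5) :
    Integrable (fun t => if |t| ≤ 1 then Complex.exp (w t) else 0) ∧
    ‖(∫ t, if |t| ≤ 1 then Complex.exp (w t) else 0) - (Real.sqrt (2 * Real.pi / s) : ℝ)‖ ≤
      400000 / u * Real.sqrt (10 * Real.pi / s) := by
  have hs0 : 0 < s := by linarith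
  obtain ⟨i1, i2⟩ := integral_edgeworth hs0 m₃
  have ib : Integrable (fun t : ℝ => 400000 / u * Real.exp (-(s / 10) * t ^ 2)) :=
    (integrable_exp_neg_mul_sq (by positivity)).const_mul _
  have hb (t : ℝ) := norm_exp_sub_edgeworth_le hu hs h₃ h₃' h₄ (hw t) (hre t)
  simp only [fun t : ℝ => (by ring : -(s * t ^ 2) / 10 = -(s / 10) * t ^ 2)] at hb
  have hm : AEStronglyMeasurable (fun t => if |t| ≤ 1 then Complex.exp (w t) else 0) volume := by
    refine (Measurable.ite (measurableSet_le (by fun_prop) (by fun_prop)) ?_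
      measurable_const).aestronglyMeasurable
    exact (Complex.continuous_exp.comp hwc).measurable
  have i0 : Integrable (fun t => if |t| ≤ 1 then Complex.exp (w t) else 0) := by
    have hd := ib.mono' (hm.sub i1.aestronglyMeasurable) (.of_forall hb)
    simpa using hd.add i1
  refine ⟨i0, ?_⟩
  rw [← i2, ← integral_sub i0 i1]
  refine (norm_integral_le_of_norm_le ib (.of_forall hb)).trans (le_of_eq ?_)
  rw [integral_const_mul, integral_gaussian]
  congr 2
  field_simp

/-! ### The inversion integrand and its negligible part. -/

/-- `e^w - 1 - w` for `w = ∫ e^{(β + it)x} ν(dx)`. -/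
noncomputable def poissonRemainder (ν : Measure ℝ) (β t : ℝ) : ℂ :=
  Complex.exp (complexMGF id ν (β + t * Complex.I)) - 1 - complexMGF id ν (β + t * Complex.I)

/-- The inversion integral of `poissonRemainder` at the point `s`. -/
noncomputable def saddleIntegral (ν : Measure ℝ) (β s : ℝ) : ℂ :=
  ∫ t : ℝ, Complex.exp (-(s * t : ℝ) * Complex.I) * poissonRemainder ν β t

section Tail

variable {ν : Measure ℝ} [IsFiniteMeasure ν]

theorem continuous_complexMGF_line (hν : ∀ᵐ x ∂ν, x ∈ Ioo (0 : ℝ) 1) (β : ℝ) :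
    Continuous fun t : ℝ => complexMGF id ν (β + t * Complex.I) := by
  have h : integrableExpSet id ν = univ := eq_univ_of_forall fun t =>
    integrable_of_continuous_unit hν (by simp only [id]; fun_prop)
  have hd : Differentiable ℂ (complexMGF id ν) := fun z =>
    (analyticAt_complexMGF (by simp [h])).differentiableAt
  exact hd.continuous.comp (by fun_prop)

omit [IsFiniteMeasure ν] in
theorem norm_complexMGF_le (β t : ℝ) :
    ‖complexMGF id ν (β + t * Complex.I)‖ ≤ tiltedMoment ν 0 β := by
  refine norm_complexMGF_le_mgf.trans (le_of_eq ?_)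
  simp [mgf, tiltedMoment]

theorem continuous_poissonRemainder (hν : ∀ᵐ x ∂ν, x ∈ Ioo (0 : ℝ) 1) (β : ℝ) :
    Continuous (poissonRemainder ν β) := by
  have := continuous_complexMGF_line hν β
  unfold poissonRemainder
  fun_prop

theorem integrable_poissonRemainder (hν : ∀ᵐ x ∂ν, x ∈ Ioo (0 : ℝ) 1) {β : ℝ}
    (h2 : Integrable fun t : ℝ => ‖complexMGF id ν (β + t * Complex.I)‖ ^ 2) :
    Integrable (poissonRemainder ν β) := by
  refine (h2.mul_const (Real.exp (tiltedMoment ν 0 β) + 2)).mono'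
    (continuous_poissonRemainder hν β).aestronglyMeasurable (.of_forall fun t => ?_)
  refine (norm_exp_sub_one_sub_id_le_sq _).trans ?_
  gcongr
  exact (Complex.re_le_norm _).trans (norm_complexMGF_le β t)

theorem integrable_exp_mul_poissonRemainder (hν : ∀ᵐ x ∂ν, x ∈ Ioo (0 : ℝ) 1) {β : ℝ}
    (h2 : Integrable fun t : ℝ => ‖complexMGF id ν (β + t * Complex.I)‖ ^ 2) (s : ℝ) :
    Integrable fun t : ℝ => Complex.exp (-(s * t : ℝ) * Complex.I) * poissonRemainder ν β t := by
  refine (integrable_poissonRemainder hν h2).bdd_mul (c := 1) (by fun_prop) (.of_forall fun t => ?_)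
  rw [← Complex.ofReal_neg, Complex.norm_exp_ofReal_mul_I]

/-- The part of the normalised inversion integrand that is negligible at the saddle point. -/
noncomputable def saddleTail (ν : Measure ℝ) (β t : ℝ) : ℂ :=
  Real.exp (-tiltedMoment ν 0 β) * poissonRemainder ν β t -
    if |t| ≤ 1 then Complex.exp (complexMGF id ν (β + t * Complex.I) - tiltedMoment ν 0 β) else 0

omit [IsFiniteMeasure ν] in
-- For `|t| ≤ 1` the exponentials cancel and only `e^{-m_0}(1 + N)` remains; for `|t| > 1` the
-- quadratic bound on the remainder combines with the saving `δ` in the real part.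
theorem norm_saddleTail_le {β δ : ℝ}
    (hδ : ∀ t : ℝ, 1 ≤ |t| →
      (complexMGF id ν (β + t * Complex.I)).re ≤ tiltedMoment ν 0 β - δ) (t : ℝ) :
    ‖saddleTail ν β t‖ ≤
      (Icc (-1 : ℝ) 1).indicator
        (fun _ => Real.exp (-tiltedMoment ν 0 β) * (1 + tiltedMoment ν 0 β)) t +
      ‖complexMGF id ν (β + t * Complex.I)‖ ^ 2 *
        (Real.exp (-δ) + 2 * Real.exp (-tiltedMoment ν 0 β)) := by
  set N := complexMGF id ν (β + t * Complex.I) with hN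
  set m := tiltedMoment ν 0 β
  unfold saddleTail poissonRemainder
  simp only [← hN]
  by_cases ht : |t| ≤ 1
  · rw [if_pos ht, indicator_of_mem (mem_Icc.2 (abs_le.1 ht))]
    refine le_add_of_le_of_nonneg ?_ (by positivity)
    have : (Real.exp (-m) : ℂ) * (Complex.exp N - 1 - N) - Complex.exp (N - m) =
        -((Real.exp (-m) : ℝ) * (1 + N)) := by
      rw [sub_eq_add_neg N, Complex.exp_add, Complex.ofReal_exp]; push_cast; ring
    rw [this, norm_neg, norm_mul, Complex.norm_real, Real.norm_of_nonneg (Real.exp_pos _).le]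
    gcongr
    refine (norm_add_le _ _).trans ?_
    rw [norm_one]
    gcongr
    exact norm_complexMGF_le β t
  · rw [if_neg ht, sub_zero, indicator_of_notMem fun h => ht (abs_le.2 (mem_Icc.1 h)), zero_add,
      norm_mul, Complex.norm_real, Real.norm_of_nonneg (Real.exp_pos _).le]
    calc _ ≤ Real.exp (-m) * (‖N‖ ^ 2 * (Real.exp N.re + 2)) := by
          gcongr; exact norm_exp_sub_one_sub_id_le_sq N
      _ ≤ Real.exp (-m) * (‖N‖ ^ 2 * (Real.exp (m - δ) + 2)) := by
          gcongr; exact hδ t (not_le.1 ht).le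
      _ = ‖N‖ ^ 2 * (Real.exp (-m) * Real.exp (m - δ) + 2 * Real.exp (-m)) := by ring
      _ = _ := by rw [← Real.exp_add]; ring_nf

theorem integrable_saddleTail (hν : ∀ᵐ x ∂ν, x ∈ Ioo (0 : ℝ) 1) {β δ L : ℝ}
    (h2 : Integrable fun t : ℝ => ‖complexMGF id ν (β + t * Complex.I)‖ ^ 2)
    (hL : ∫ t : ℝ, ‖complexMGF id ν (β + t * Complex.I)‖ ^ 2 ≤ L)
    (hδ : ∀ t : ℝ, 1 ≤ |t| →
      (complexMGF id ν (β + t * Complex.I)).re ≤ tiltedMoment ν 0 β - δ) :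
    Integrable (saddleTail ν β) ∧ ∫ t, ‖saddleTail ν β t‖ ≤
      2 * (Real.exp (-tiltedMoment ν 0 β) * (1 + tiltedMoment ν 0 β)) +
        L * (Real.exp (-δ) + 2 * Real.exp (-tiltedMoment ν 0 β)) := by
  have i1 : Integrable ((Icc (-1 : ℝ) 1).indicator
      (fun _ => Real.exp (-tiltedMoment ν 0 β) * (1 + tiltedMoment ν 0 β))) :=
    (integrable_indicator_iff measurableSet_Icc).2 (integrableOn_const (by simp))
  have i2 := h2.mul_const (Real.exp (-δ) + 2 * Real.exp (-tiltedMoment ν 0 β))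
  have hm : AEStronglyMeasurable (saddleTail ν β) volume := by
    have h1 := continuous_complexMGF_line hν β
    have h3 := (continuous_poissonRemainder hν β).measurable
    refine ((h3.const_mul _).sub (Measurable.ite (measurableSet_le (by fun_prop) (by fun_prop)) ?_
      measurable_const)).aestronglyMeasurable
    exact (Complex.continuous_exp.comp (h1.sub continuous_const)).measurable
  have hi : Integrable (saddleTail ν β) :=
    (i1.add i2).mono' hm (.of_forall fun t => norm_saddleTail_le hδ t)
  refine ⟨hi, ?_⟩
  refine (integral_mono hi.norm (i1.add i2) (norm_saddleTail_le hδ)).trans ?_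
  rw [integral_add' i1 i2, integral_indicator measurableSet_Icc,
    integral_mul_const (Real.exp (-δ) + _)]
  refine add_le_add (by norm_num [mul_assoc]) ?_
  gcongr

end Tail

/-! ### Saddle point asymptotics from abstract regularity of `ν`. -/

/-- The hypotheses on the Lévy measure that make the saddle point approximation work. -/
structure SaddleRegular (ν : Measure ℝ) (c L : ℝ) : Prop where
  unit : ∀ᵐ x ∂ν, x ∈ Ioo (0 : ℝ) 1
  pos : 0 < c
  moment_ge : ∀ᶠ β : ℝ in atTop, c * Real.exp β / β ≤ tiltedMoment ν 1 β
  integrable_sq : ∀ β : ℝ, Integrable fun t : ℝ => ‖complexMGF id ν (β + t * Complex.I)‖ ^ 2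
  integral_sq_le : ∀ β : ℝ, 0 ≤ β →
    ∫ t : ℝ, ‖complexMGF id ν (β + t * Complex.I)‖ ^ 2 ≤ L * Real.exp (2 * β)
  re_le : ∀ᶠ β : ℝ in atTop, ∀ t : ℝ, 1 ≤ |t| →
    (complexMGF id ν (β + t * Complex.I)).re ≤ tiltedMoment ν 0 β - c * Real.exp β / β ^ 3

namespace SaddleRegular

variable {ν : Measure ℝ} [IsFiniteMeasure ν] {c L : ℝ} (h : SaddleRegular ν c L)
include h

/-- Since `δ = c e^β/β³` eventually exceeds `4β`, the factor `e^{-δ}` beats `e^{4β}`: two powers of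
`e^β` come from the L² bound, two from `u² ≤ (ν(ℝ) e^β)²`. -/
theorem integral_saddleTail_le : ∃ A, 0 ≤ A ∧ ∀ᶠ β : ℝ in atTop, Integrable (saddleTail ν β) ∧
    ∫ t, ‖saddleTail ν β t‖ ≤ A / tiltedMoment ν 1 β ^ 2 := by
  have hL : 0 ≤ L := by
    have := (integral_nonneg fun t => by positivity).trans (h.integral_sq_le 0 le_rfl)
    simpa using this
  refine ⟨ν.real univ ^ 2 * (2 + 2 * ν.real univ + 3 * L), by positivity, ?_⟩
  have hexp : ∀ᶠ β : ℝ in atTop, 4 / c ≤ Real.exp β / β ^ 4 :=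
    (Real.tendsto_exp_div_pow_atTop 4).eventually_ge_atTop _
  filter_upwards [h.moment_ge, h.re_le, hexp, eventually_ge_atTop 1] with β h1 h3 h4 hβ
  have hc := h.pos
  have hβ0 : 0 < β := by linarith
  set Λ := ν.real univ
  have hΛ : 0 ≤ Λ := measureReal_nonneg
  set m := tiltedMoment ν 0 β
  set u := tiltedMoment ν 1 β
  set δ := c * Real.exp β / β ^ 3
  have hu : 0 < u := lt_of_lt_of_le (by positivity) h1
  have hum : u ≤ m := tiltedMoment_antitone h.unit β (Nat.zero_le 1)
  have hmΛ : m ≤ Λ * Real.exp β := tiltedMoment_zero_le h.unit hβ0.le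
  have hδ4 : 4 * β ≤ δ := by
    rw [div_le_div_iff₀ hc (by positivity)] at h4
    rw [le_div_iff₀ (by positivity)]
    nlinarith
  have hδm : δ ≤ m := by
    refine le_trans (le_trans ?_ h1) hum
    exact div_le_div_of_nonneg_left (by positivity) hβ0 (le_self_pow₀ hβ (by norm_num))
  obtain ⟨hi, hb⟩ := integrable_saddleTail h.unit (h.integrable_sq β)
    (h.integral_sq_le β hβ0.le) h3
  refine ⟨hi, hb.trans ?_⟩
  rw [le_div_iff₀ (by positivity)]
  have hem : Real.exp (-m) ≤ Real.exp (-δ) := Real.exp_le_exp.2 (by linarith)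
  have he1 : 1 ≤ Real.exp β := Real.one_le_exp hβ0.le
  have he2 : Real.exp (2 * β) = Real.exp β ^ 2 := by rw [← Real.exp_nat_mul]; norm_num
  have hd : Real.exp (-δ) * Real.exp β ^ 4 ≤ 1 := by
    rw [← Real.exp_nat_mul, ← Real.exp_add]
    refine Real.exp_le_one_iff.2 ?_
    push_cast; linarith
  have hm1 : 1 + m ≤ (1 + Λ) * Real.exp β ^ 2 := by
    have : Real.exp β ≤ Real.exp β ^ 2 := le_self_pow₀ he1 (by norm_num)
    nlinarith
  have hm0 : 0 ≤ 1 + m := by linarith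
  calc _ ≤ (2 * (Real.exp (-δ) * ((1 + Λ) * Real.exp β ^ 2)) +
        L * Real.exp β ^ 2 * (Real.exp (-δ) + 2 * Real.exp (-δ))) * (Λ * Real.exp β) ^ 2 := by
        rw [he2]
        gcongr
        exact hum.trans hmΛ
    _ = Λ ^ 2 * (2 + 2 * Λ + 3 * L) * (Real.exp (-δ) * Real.exp β ^ 4) := by ring
    _ ≤ _ := mul_le_of_le_one_right (by positivity) hd

theorem moment_two_ge : ∀ᶠ β : ℝ in atTop, tiltedMoment ν 1 β / 4 ≤ tiltedMoment ν 2 β := by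
  have hexp : ∀ᶠ β : ℝ in atTop, 8 * ν.real univ / c ≤ Real.exp (β / 2) / (β / 2) ^ 1 :=
    ((Real.tendsto_exp_div_pow_atTop 1).comp
      (tendsto_id.atTop_div_const two_pos)).eventually_ge_atTop _
  filter_upwards [h.moment_ge, hexp, eventually_ge_atTop 1] with β h1 h4 hβ
  have h2 := tiltedMoment_one_le_two h.unit (zero_le_one.trans hβ)
  have hc := h.pos
  have hβ0 : 0 < β := by linarith
  rw [div_le_div_iff₀ hc (by positivity), pow_one] at h4
  rw [div_le_iff₀ hβ0] at h1
  have he : Real.exp β = Real.exp (β / 2) * Real.exp (β / 2) := by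
    rw [← Real.exp_add]; ring_nf
  have hp := Real.exp_pos (β / 2)
  rw [he] at h1
  have : 4 * (ν.real univ * Real.exp (β / 2)) * β ≤ tiltedMoment ν 1 β * β := by nlinarith
  have := le_of_mul_le_mul_right this hβ0
  linarith

omit [IsFiniteMeasure ν] in
theorem tendsto_moment_one : Tendsto (tiltedMoment ν 1) atTop atTop := by
  refine tendsto_atTop_mono' _ h.moment_ge ?_
  have := (Real.tendsto_exp_div_pow_atTop 1).const_mul_atTop h.pos
  refine this.congr fun β => ?_
  rw [pow_one, mul_div_assoc]

end SaddleRegular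

theorem exp_neg_mul_abs_le {s : ℝ} (hs : 0 < s) (t : ℝ) :
    Real.exp (-(s * t ^ 2) / 5) * |t| ≤ 10 / Real.sqrt s * Real.exp (-(s / 10) * t ^ 2) := by
  have hr : 0 < Real.sqrt s := Real.sqrt_pos.2 hs
  have h1 := Real.add_one_le_exp (s * t ^ 2 / 10)
  have h2 : Real.sqrt s * |t| ≤ 10 * Real.exp (s * t ^ 2 / 10) := by
    have : (Real.sqrt s * |t|) ^ 2 = s * t ^ 2 := by rw [mul_pow, Real.sq_sqrt hs.le, sq_abs]
    nlinarith [sq_nonneg (Real.sqrt s * |t| - 1)]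
  have h3 : |t| ≤ 10 / Real.sqrt s * Real.exp (s * t ^ 2 / 10) := by
    rw [div_mul_eq_mul_div, le_div_iff₀ hr]; linarith
  calc _ ≤ Real.exp (-(s * t ^ 2) / 5) * (10 / Real.sqrt s * Real.exp (s * t ^ 2 / 10)) := by gcongr
    _ = 10 / Real.sqrt s * (Real.exp (-(s * t ^ 2) / 5) * Real.exp (s * t ^ 2 / 10)) := by ring
    _ = _ := by rw [← Real.exp_add]; ring_nf

theorem norm_exp_neg_mul_I_sub_one_le (x : ℝ) :
    ‖Complex.exp (-(x : ℝ) * Complex.I) - 1‖ ≤ |x| := by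
  have := Real.norm_exp_I_mul_ofReal_sub_one_le (x := -x)
  rw [mul_comm] at this
  simpa using this

theorem sqrt_mul_pi_div_le {a s : ℝ} (ha : a ≤ 10) (hs : 0 < s) :
    Real.sqrt (a * Real.pi / s) ≤ 6 / Real.sqrt s := by
  rw [Real.sqrt_div' _ hs.le]
  gcongr
  refine Real.sqrt_le_iff.2 ⟨by norm_num, ?_⟩
  nlinarith [Real.pi_pos, Real.pi_lt_d2]

namespace SaddleRegular

variable {ν : Measure ℝ} [IsFiniteMeasure ν] {c L : ℝ} (h : SaddleRegular ν c L)
include h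

/-- The second estimate keeps the tilt belonging to `u` while the point moves to `u + v`: the phase
difference is at most `v|t|`, and `|t|` has Gaussian integral of order `1/s`. -/
theorem saddleIntegral_asymptotics : ∃ A, 0 ≤ A ∧ ∀ᶠ β : ℝ in atTop,
    ‖Real.exp (-tiltedMoment ν 0 β) * saddleIntegral ν β (tiltedMoment ν 1 β) -
        (Real.sqrt (2 * Real.pi / tiltedMoment ν 2 β) : ℝ)‖ ≤
      A / (tiltedMoment ν 1 β * Real.sqrt (tiltedMoment ν 2 β)) ∧
    ∀ v : ℝ, 0 ≤ v → ‖Real.exp (-tiltedMoment ν 0 β) *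
        (saddleIntegral ν β (tiltedMoment ν 1 β + v) - saddleIntegral ν β (tiltedMoment ν 1 β))‖ ≤
      A * (v / tiltedMoment ν 2 β +
        1 / (tiltedMoment ν 1 β * Real.sqrt (tiltedMoment ν 2 β))) := by
  obtain ⟨A, hA, hev⟩ := h.integral_saddleTail_le
  -- `2400000 = 400000 · 6` is the central error with `√(10π) ≤ 6`; `2A` comes from `|e^{-ivt} - 1|
  -- ≤ 2` on the tail.
  refine ⟨2400000 + 2 * A, by positivity, ?_⟩
  filter_upwards [hev, h.moment_two_ge, h.tendsto_moment_one.eventually_ge_atTop 1] with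
    β ⟨hi, htail⟩ h24 hu1
  have hm31 : tiltedMoment ν 3 β ≤ tiltedMoment ν 1 β :=
    tiltedMoment_antitone h.unit β (by norm_num)
  have hm41 : tiltedMoment ν 4 β ≤ tiltedMoment ν 1 β :=
    tiltedMoment_antitone h.unit β (by norm_num)
  have hm21 : tiltedMoment ν 2 β ≤ tiltedMoment ν 1 β :=
    tiltedMoment_antitone h.unit β (by norm_num)
  have hm30 := tiltedMoment_nonneg h.unit 3 β
  have htay := fun t : ℝ => complexMGF_taylor h.unit β (t := t)
  have hre := fun t : ℝ => re_complexMGF_le h.unit β (t := t)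
  set m := tiltedMoment ν 0 β
  set u := tiltedMoment ν 1 β
  set s := tiltedMoment ν 2 β
  have hs : 0 < s := by linarith
  set r := Real.sqrt s
  have hr : 0 < r := Real.sqrt_pos.2 hs
  have hru : r ≤ u := Real.sqrt_le_iff.2 ⟨by linarith, by nlinarith⟩
  have htail' : ∫ t, ‖saddleTail ν β t‖ ≤ A / (u * r) :=
    htail.trans (div_le_div_of_nonneg_left hA (by positivity) (by nlinarith))
  have hphase (x t : ℝ) : ‖Complex.exp (-(x * t : ℝ) * Complex.I)‖ = 1 := by
    rw [← Complex.ofReal_neg, Complex.norm_exp_ofReal_mul_I]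
  -- The phase `-iut` cancels the linear Taylor term exactly because `u` is the first moment: this
  -- is the saddle point condition.
  set w : ℝ → ℂ := fun t =>
    complexMGF id ν (β + t * Complex.I) - m + -(u * t : ℝ) * Complex.I with hw
  have hwc : Continuous w := by
    have := continuous_complexMGF_line h.unit β
    fun_prop
  have hwre (t : ℝ) : (w t).re = (complexMGF id ν (β + t * Complex.I)).re - m := by
    simp only [hw]
    rw [← Complex.ofReal_neg, Complex.add_re, Complex.sub_re, Complex.re_ofReal_mul, Complex.I_re,
      Complex.ofReal_re]
    ring
  obtain ⟨hci, hcb⟩ := norm_integral_central_sub_le (w := w) hu1 h24 hm30 hm31 hm41 hwc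
    (fun t ht => by
      refine le_trans (le_of_eq ?_) (htay t ht)
      congr 1
      simp only [hw]
      push_cast
      ring)
    (fun t ht => by rw [hwre]; linarith [hre t ht])
  have hsplit (t : ℝ) : Real.exp (-m) * (Complex.exp (-(u * t : ℝ) * Complex.I) *
      poissonRemainder ν β t) = (if |t| ≤ 1 then Complex.exp (w t) else 0) +
        Complex.exp (-(u * t : ℝ) * Complex.I) * saddleTail ν β t := by
    have : (if |t| ≤ 1 then Complex.exp (w t) else 0) = Complex.exp (-(u * t : ℝ) * Complex.I) *
        if |t| ≤ 1 then Complex.exp (complexMGF id ν (β + t * Complex.I) - m) else 0 := by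
      split_ifs
      · rw [← Complex.exp_add, add_comm]
      · rw [mul_zero]
    rw [this, saddleTail]
    ring
  have hti : Integrable fun t : ℝ => Complex.exp (-(u * t : ℝ) * Complex.I) * saddleTail ν β t :=
    hi.bdd_mul (c := 1) (by fun_prop) (.of_forall fun t => (hphase u t).le)
  have e6 := sqrt_mul_pi_div_le (a := 10) le_rfl hs
  constructor
  · have heq : Real.exp (-m) * saddleIntegral ν β u =
        (∫ t, if |t| ≤ 1 then Complex.exp (w t) else 0) +
          ∫ t : ℝ, Complex.exp (-(u * t : ℝ) * Complex.I) * saddleTail ν β t := by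
      rw [saddleIntegral, ← integral_const_mul, ← integral_add hci hti]
      exact integral_congr_ae (.of_forall hsplit)
    have ht2 : ‖∫ t : ℝ, Complex.exp (-(u * t : ℝ) * Complex.I) * saddleTail ν β t‖ ≤
        A / (u * r) := by
      refine (norm_integral_le_integral_norm _).trans (le_trans (le_of_eq ?_) htail')
      exact integral_congr_ae (.of_forall fun t => by simp only [norm_mul, hphase, one_mul])
    rw [heq, add_sub_right_comm]
    refine (norm_add_le _ _).trans ((add_le_add hcb ht2).trans ?_)
    calc _ ≤ 400000 / u * (6 / r) + A / (u * r) := by gcongr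
      _ = (2400000 + A) / (u * r) := by field_simp; ring
      _ ≤ _ := by gcongr; linarith
  · intro v hv
    have i1 := integrable_exp_mul_poissonRemainder h.unit (h.integrable_sq β) (u + v)
    have i2 := integrable_exp_mul_poissonRemainder h.unit (h.integrable_sq β) u
    rw [saddleIntegral, saddleIntegral, ← integral_sub i1 i2, ← integral_const_mul]
    have ig : Integrable fun t : ℝ => v * (10 / r * Real.exp (-(s / 10) * t ^ 2)) :=
      ((integrable_exp_neg_mul_sq (by positivity)).const_mul _).const_mul _
    have hpt (t : ℝ) : ‖Real.exp (-m) * (Complex.exp (-((u + v) * t : ℝ) * Complex.I) *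
        poissonRemainder ν β t - Complex.exp (-(u * t : ℝ) * Complex.I) *
          poissonRemainder ν β t)‖ ≤
        v * (10 / r * Real.exp (-(s / 10) * t ^ 2)) + 2 * ‖saddleTail ν β t‖ := by
      have e : Real.exp (-m) * (Complex.exp (-((u + v) * t : ℝ) * Complex.I) *
          poissonRemainder ν β t - Complex.exp (-(u * t : ℝ) * Complex.I) *
          poissonRemainder ν β t) = (Complex.exp (-(v * t : ℝ) * Complex.I) - 1) *
          ((if |t| ≤ 1 then Complex.exp (w t) else 0) +
            Complex.exp (-(u * t : ℝ) * Complex.I) * saddleTail ν β t) := by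
        rw [← hsplit]
        have : Complex.exp (-((u + v) * t : ℝ) * Complex.I) =
            Complex.exp (-(v * t : ℝ) * Complex.I) * Complex.exp (-(u * t : ℝ) * Complex.I) := by
          rw [← Complex.exp_add]; push_cast; ring_nf
        rw [this]; ring
      rw [e, mul_add]
      refine (norm_add_le _ _).trans (add_le_add ?_ ?_)
      · have hb : ‖if |t| ≤ 1 then Complex.exp (w t) else 0‖ ≤ Real.exp (-(s * t ^ 2) / 5) := by
          split_ifs with ht
          · rw [Complex.norm_exp, hwre]
            exact Real.exp_le_exp.2 (by linarith [hre t ht])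
          · rw [norm_zero]; positivity
        rw [norm_mul]
        calc _ ≤ |v * t| * Real.exp (-(s * t ^ 2) / 5) :=
              mul_le_mul (norm_exp_neg_mul_I_sub_one_le _) hb (norm_nonneg _) (abs_nonneg _)
          _ = v * (Real.exp (-(s * t ^ 2) / 5) * |t|) := by rw [abs_mul, abs_of_nonneg hv]; ring
          _ ≤ _ := mul_le_mul_of_nonneg_left (exp_neg_mul_abs_le hs t) hv
      · rw [norm_mul, norm_mul, hphase, one_mul]
        gcongr
        refine (norm_sub_le _ _).trans ?_
        rw [hphase, norm_one]; norm_num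
    refine (norm_integral_le_of_norm_le (ig.add (hi.norm.const_mul 2))
      (.of_forall hpt)).trans ?_
    rw [integral_add' ig (hi.norm.const_mul 2), integral_const_mul, integral_const_mul,
      integral_const_mul, integral_gaussian, (by field_simp : Real.pi / (s / 10) = 10 * Real.pi / s)]
    have hrr : r * r = s := Real.mul_self_sqrt hs.le
    calc _ ≤ v * (10 / r * (6 / r)) + 2 * (A / (u * r)) := by gcongr
      _ = v * (60 / (r * r)) + 2 * A * (1 / (u * r)) := by field_simp; ring
      _ = 60 * (v / s) + 2 * A * (1 / (u * r)) := by rw [hrr]; ring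
      _ ≤ (2400000 + 2 * A) * (v / s) + (2400000 + 2 * A) * (1 / (u * r)) := by
        gcongr <;> linarith
      _ = _ := by ring

end SaddleRegular

/-! ### Plancherel for integrable square-integrable functions. -/

open scoped FourierTransform in
-- Both transforms have the same integrals against smooth compactly supported functions: each moves
-- the Fourier transform onto the test function, one by Fubini, the other by its definition on
-- tempered distributions.
theorem fourier_ae_eq_fourier_toLp {f : ℝ → ℂ} (h1 : Integrable f) (h2 : MemLp f 2) :
    𝓕 f =ᵐ[volume] (𝓕 (h2.toLp f) : Lp ℂ 2 (volume : Measure ℝ)) := by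
  have hc : Continuous (𝓕 f) := VectorFourier.fourierIntegral_continuous
    Real.continuous_fourierChar continuous_inner h1
  refine ae_eq_of_integral_contDiff_smul_eq hc.locallyIntegrable
    ((Lp.memLp _).locallyIntegrable (by norm_num)) fun φ hφ hφc => ?_
  have hg₁ : HasCompactSupport (Complex.ofRealCLM ∘ φ) := hφc.comp_left rfl
  have hg₂ : ContDiff ℝ (↑(⊤ : ℕ∞)) (Complex.ofRealCLM ∘ φ) := by fun_prop
  set ψ := hg₁.toSchwartzMap hg₂
  have hψ (x : ℝ) : ψ x = (φ x : ℂ) := rfl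
  have e1 := congrArg (fun T => T ψ) (Lp.fourier_toTemperedDistribution_eq (h2.toLp f))
  simp only [TemperedDistribution.fourier_apply, Lp.toTemperedDistribution_apply, hψ] at e1
  have e2 : ∫ x, (𝓕 ψ) x • (h2.toLp f) x = ∫ x, (𝓕 ψ) x • f x :=
    integral_congr_ae (h2.coeFn_toLp.mono fun x hx => by simp only [hx])
  have e3 : ∫ x, ψ x • (𝓕 f) x = ∫ x, (𝓕 ψ) x • f x := by
    have := VectorFourier.integral_fourierIntegral_smul_eq_flip (L := innerₗ ℝ)
      Real.continuous_fourierChar continuous_inner ψ.integrable h1 (μ := volume) (ν := volume)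
    rw [flip_innerₗ] at this
    exact this.symm
  simp only [← Complex.coe_smul]
  exact (e3.trans (e2.symm.trans e1))

open scoped FourierTransform in
theorem integral_sq_norm_fourier {f : ℝ → ℂ} (h1 : Integrable f) (h2 : MemLp f 2) :
    Integrable (fun t => ‖𝓕 f t‖ ^ 2) ∧ ∫ t, ‖𝓕 f t‖ ^ 2 = ∫ x, ‖f x‖ ^ 2 := by
  have key (F : Lp ℂ 2 (volume : Measure ℝ)) : ((‖F‖ ^ 2 : ℝ) : ℂ) = (∫ x, ‖F x‖ ^ 2 : ℝ) := by
    have h := L2.inner_def (𝕜 := ℂ) F F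
    rw [inner_self_eq_norm_sq_to_K] at h
    simp only [inner_self_eq_norm_sq_to_K] at h
    push_cast
    refine h.trans ?_
    rw [← integral_complex_ofReal]
    simp
  have hae := fourier_ae_eq_fourier_toLp h1 h2
  have hm : MemLp (𝓕 f) 2 := (memLp_congr_ae hae).2 (Lp.memLp _)
  refine ⟨(memLp_two_iff_integrable_sq_norm hm.1).1 hm, ?_⟩
  have e1 : ∫ t, ‖𝓕 f t‖ ^ 2 = ∫ t, ‖(𝓕 (h2.toLp f) : Lp ℂ 2 (volume : Measure ℝ)) t‖ ^ 2 :=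
    integral_congr_ae (hae.mono fun x hx => by simp only [hx])
  have e2 : ∫ t, ‖(h2.toLp f) t‖ ^ 2 = ∫ t, ‖f t‖ ^ 2 :=
    integral_congr_ae (h2.coeFn_toLp.mono fun x hx => by simp only [hx])
  rw [e1, ← e2]
  have k1 := key (𝓕 (h2.toLp f))
  have k2 := key (h2.toLp f)
  rw [Lp.norm_fourier_eq] at k1
  exact_mod_cast k1.symm.trans k2

/-! ### Regularity of the Lévy measure. -/

/-- The properties of the Lévy density that the saddle point argument uses. -/
structure UnitLevyDensity (G : ℝ → ℝ) (S : Set ℝ) (M ε a : ℝ) : Prop where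
  finite : S.Finite
  subset : S ⊆ Icc 0 1
  continuousAt : ∀ x, x ∉ S → ContinuousAt G x
  nonneg : ∀ x, 0 ≤ G x
  le : ∀ x, G x ≤ M
  support : ∀ x, x ∉ Ioo (0 : ℝ) 1 → G x = 0
  pos : 0 < ε
  half_le : 1 / 2 ≤ a
  lt_one : a < 1
  lower : ∀ x ∈ Ioo a 1, ε ≤ G x

/-- The measure `G(x) dx`. -/
noncomputable def levyMeasure (G : ℝ → ℝ) : Measure ℝ :=
  volume.withDensity fun x => ENNReal.ofReal (G x)

namespace UnitLevyDensity

variable {G : ℝ → ℝ} {S : Set ℝ} {M ε a : ℝ} (h : UnitLevyDensity G S M ε a)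
include h

theorem measurable : Measurable G := by
  refine measurable_of_measurable_on_compl_finite S h.finite (Continuous.measurable ?_)
  exact continuousOn_iff_continuous_domRestrict.1
    (continuousOn_of_forall_continuousAt fun x hx => h.continuousAt x hx)

theorem bound_nonneg : 0 ≤ M := (h.nonneg 0).trans (h.le 0)

theorem integrable_mul {E : Type*} [NormedAddCommGroup E] [NormedSpace ℝ E]
    {φ : ℝ → E} (hφ : Continuous φ) :
    Integrable fun x => G x • φ x := by
  obtain ⟨C, hC⟩ := (isCompact_Icc (a := (0 : ℝ)) (b := 1)).exists_bound_of_continuousOn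
    hφ.continuousOn
  have hi : Integrable ((Ioo (0 : ℝ) 1).indicator fun _ => M * C) :=
    (integrable_indicator_iff measurableSet_Ioo).2 (integrableOn_const (by simp))
  refine hi.mono' (h.measurable.aestronglyMeasurable.smul hφ.aestronglyMeasurable)
    (.of_forall fun x => ?_)
  by_cases hx : x ∈ Ioo (0 : ℝ) 1
  · rw [indicator_of_mem hx, norm_smul, Real.norm_of_nonneg (h.nonneg x)]
    exact mul_le_mul (h.le x) (hC x (Ioo_subset_Icc_self hx)) (norm_nonneg _) h.bound_nonneg
  · rw [indicator_of_notMem hx, h.support x hx, zero_smul, norm_zero]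

theorem integrable : Integrable G := by
  simpa using h.integrable_mul (continuous_const (y := (1 : ℝ)))

theorem isFiniteMeasure : IsFiniteMeasure (levyMeasure G) :=
  isFiniteMeasure_withDensity_ofReal h.integrable.2

theorem ae_unit : ∀ᵐ x ∂levyMeasure G, x ∈ Ioo (0 : ℝ) 1 := by
  rw [levyMeasure, ae_withDensity_iff (by have := h.measurable; fun_prop)]
  refine .of_forall fun x hx => ?_
  by_contra hx'
  exact hx (by rw [h.support x hx', ENNReal.ofReal_zero])

theorem integral_levyMeasure {E : Type*} [NormedAddCommGroup E] [NormedSpace ℝ E] (φ : ℝ → E) :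
    ∫ x, φ x ∂levyMeasure G = ∫ x, G x • φ x := by
  rw [levyMeasure, integral_withDensity_eq_integral_toReal_smul
    (by have := h.measurable; fun_prop) (by simp)]
  exact integral_congr_ae (.of_forall fun x => by
    simp only [ENNReal.toReal_ofReal (h.nonneg x)])

/-- The lower bound on `G` near `1` enters only here: `ν` is replaced by `ε dx` on `(a, 1)`, where
integrals are explicit. -/
theorem le_integral_levyMeasure {φ : ℝ → ℝ} (hφ : Continuous φ) (hφ0 : ∀ x, 0 ≤ x → 0 ≤ φ x) :
    ε * ∫ x in a..1, φ x ≤ ∫ x, φ x ∂levyMeasure G := by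
  have ha := h.half_le
  rw [h.integral_levyMeasure, intervalIntegral.integral_of_le h.lt_one.le, integral_Ioc_eq_integral_Ioo,
    ← integral_const_mul, ← integral_indicator measurableSet_Ioo]
  refine integral_mono ?_ (h.integrable_mul hφ) fun x => ?_
  · refine (integrable_indicator_iff measurableSet_Ioo).2 ?_
    exact ((hφ.const_mul ε).integrableOn_Icc (a := a) (b := 1)).mono_set Ioo_subset_Icc_self
  · by_cases hx : x ∈ Ioo a 1
    · rw [indicator_of_mem hx]
      exact mul_le_mul_of_nonneg_right (h.lower x hx) (hφ0 x (by linarith [hx.1]))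
    · rw [indicator_of_notMem hx]
      by_cases h0 : 0 ≤ x
      · exact mul_nonneg (h.nonneg x) (hφ0 x h0)
      · dsimp only; rw [h.support x fun hx => h0 hx.1.le, zero_smul]

omit h in
theorem integral_exp_mul_interval {β : ℝ} (hβ : β ≠ 0) (b d : ℝ) :
    ∫ x in b..d, Real.exp (β * x) = (Real.exp (β * d) - Real.exp (β * b)) / β := by
  have := integral_exp_mul_complex (a := b) (b := d) (Complex.ofReal_ne_zero.2 hβ)
  simp only [← Complex.ofReal_mul, ← Complex.ofReal_exp] at this
  rw [intervalIntegral.integral_ofReal] at this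
  exact_mod_cast this

omit h in
theorem integral_exp_mul_cos_le {β t : ℝ} (hβ : 1 ≤ β) (ht : 1 ≤ |t|) (b d : ℝ) :
    ∫ x in b..d, Real.exp (β * x) * Real.cos (t * x) ≤
      (Real.exp (β * d) + Real.exp (β * b)) / (β + 1 / (4 * β)) := by
  have hβ0 : 0 < β := by linarith
  set z : ℂ := β + t * Complex.I with hz
  -- `|z|² ≥ β² + 1` uniformly in `|t| ≥ 1`, whereas `(β + 1/(4β))²` is `β² + 1/2` plus at most
  -- `1/16`.
  have hzn : β + 1 / (4 * β) ≤ ‖z‖ := by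
    rw [hz, Complex.norm_add_mul_I]
    refine Real.le_sqrt_of_sq_le ?_
    have h1 : 1 ≤ t ^ 2 := by rw [← sq_abs]; exact one_le_pow₀ ht
    have h2 : (β + 1 / (4 * β)) ^ 2 = β ^ 2 + 1 / 2 + (1 / (4 * β)) ^ 2 := by field_simp; ring
    have h3 : 1 / (4 * β) ≤ 1 / 4 := by
      apply one_div_le_one_div_of_le <;> linarith
    have h4 : 0 ≤ 1 / (4 * β) := by positivity
    nlinarith
  have hz0 : z ≠ 0 := norm_pos_iff.1 (lt_of_lt_of_le (by positivity) hzn)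
  have hi := integral_exp_mul_complex (a := b) (b := d) hz0
  have hre : ∫ x in b..d, Real.exp (β * x) * Real.cos (t * x) =
      (∫ x in b..d, Complex.exp (z * x)).re := by
    have hc : IntervalIntegrable (fun x : ℝ => Complex.exp (z * x)) volume b d :=
      (by fun_prop : Continuous fun x : ℝ => Complex.exp (z * x)).intervalIntegrable _ _
    have := Complex.reCLM.intervalIntegral_comp_comm hc
    simp only [Complex.reCLM_apply] at this
    rw [← this]
    refine intervalIntegral.integral_congr fun x _ => ?_
    simp [hz, Complex.exp_re]
  have hn (x : ℝ) : ‖Complex.exp (z * x)‖ = Real.exp (β * x) := by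
    rw [Complex.norm_exp]; simp [hz]
  rw [hre, hi]
  refine (Complex.re_le_norm _).trans ?_
  rw [norm_div]
  refine div_le_div₀ (by positivity) ((norm_sub_le _ _).trans ?_) (by positivity) hzn
  rw [hn, hn]

theorem exp_eventually : ∀ᶠ β : ℝ in atTop,
    1 ≤ β ∧ 20 * β ^ 2 * Real.exp (β * a) ≤ Real.exp β := by
  have h1a : 0 < 1 - a := sub_pos.2 h.lt_one
  have hexp : ∀ᶠ β : ℝ in atTop,
      20 / (1 - a) ^ 2 ≤ Real.exp ((1 - a) * β) / ((1 - a) * β) ^ 2 :=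
    ((Real.tendsto_exp_div_pow_atTop 2).comp
      (tendsto_id.const_mul_atTop h1a)).eventually_ge_atTop _
  filter_upwards [hexp, eventually_ge_atTop 1] with β h1 hβ
  refine ⟨hβ, ?_⟩
  rw [div_le_div_iff₀ (by positivity) (by positivity)] at h1
  have h2 : 20 * β ^ 2 ≤ Real.exp ((1 - a) * β) := by
    refine le_of_mul_le_mul_right ?_ (by positivity : 0 < (1 - a) ^ 2)
    linarith
  calc _ ≤ Real.exp ((1 - a) * β) * Real.exp (β * a) := by gcongr
    _ = _ := by rw [← Real.exp_add]; ring_nf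

theorem moment_ge : ∀ᶠ β : ℝ in atTop,
    ε / 10 * Real.exp β / β ≤ tiltedMoment (levyMeasure G) 1 β := by
  have := h.isFiniteMeasure
  filter_upwards [h.exp_eventually] with β ⟨hβ, hexp⟩
  have hβ0 : 0 < β := by linarith
  have hε := h.pos
  have hl := h.le_integral_levyMeasure (φ := fun x => x ^ 1 * Real.exp (β * x)) (by fun_prop)
    fun x hx => by positivity
  refine le_trans ?_ hl
  have hm : ∫ x in a..1, 1 / 2 * Real.exp (β * x) ≤ ∫ x in a..1, x ^ 1 * Real.exp (β * x) := by
    refine intervalIntegral.integral_mono_on h.lt_one.le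
      ((by fun_prop : Continuous _).intervalIntegrable _ _)
      ((by fun_prop : Continuous _).intervalIntegrable _ _) fun x hx => ?_
    have := h.half_le.trans hx.1
    rw [pow_one]; gcongr
  rw [intervalIntegral.integral_const_mul, integral_exp_mul_interval hβ0.ne', mul_one] at hm
  have : ε * (1 / 2 * ((Real.exp β - Real.exp (β * a)) / β)) ≤
      ε * ∫ x in a..1, x ^ 1 * Real.exp (β * x) := by gcongr
  refine le_trans ?_ this
  have he : Real.exp (β * a) ≤ Real.exp β / 2 := by
    nlinarith [Real.exp_pos (β * a), one_le_pow₀ hβ (n := 2)]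
  calc _ = ε * (1 / 10 * (Real.exp β / β)) := by ring
    _ ≤ ε * (1 / 2 * ((Real.exp β / 2) / β)) := by
      gcongr ε * ?_
      rw [div_right_comm]
      linarith [(by positivity : 0 < Real.exp β / β)]
    _ ≤ _ := by gcongr; linarith

/-- The gap `∫ e^{βx}(1 - cos tx) ν(dx)` is at least `ε` times its integral over `(a, 1)`. There the
endpoint `1` contributes `e^β (1/β - 1/(β + 1/(4β)))`, of order `e^β/β³`, and the endpoint `a` is
negligible by `exp_eventually`. -/
theorem re_le : ∀ᶠ β : ℝ in atTop, ∀ t : ℝ, 1 ≤ |t| →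
    (complexMGF id (levyMeasure G) (β + t * Complex.I)).re ≤
      tiltedMoment (levyMeasure G) 0 β - ε / 10 * Real.exp β / β ^ 3 := by
  have := h.isFiniteMeasure
  filter_upwards [h.exp_eventually] with β ⟨hβ, hexp⟩ t ht
  have hβ0 : 0 < β := by linarith
  have hε := h.pos
  have hl := h.le_integral_levyMeasure
    (φ := fun x => x ^ 0 * Real.exp (β * x) - Real.exp (β * x) * Real.cos (t * x)) (by fun_prop)
    fun x _ => by nlinarith [Real.exp_pos (β * x), Real.cos_le_one (t * x)]
  rw [integral_sub (integrable_tilted h.ae_unit 0 β)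
    (integrable_of_continuous_unit h.ae_unit (by fun_prop)), ← re_complexMGF h.ae_unit] at hl
  change _ ≤ tiltedMoment _ 0 β - _ at hl
  rw [intervalIntegral.integral_sub ((by fun_prop : Continuous _).intervalIntegrable _ _)
    ((by fun_prop : Continuous _).intervalIntegrable _ _)] at hl
  simp only [pow_zero, one_mul] at hl
  rw [integral_exp_mul_interval hβ0.ne'] at hl
  have hc := integral_exp_mul_cos_le hβ ht a 1
  rw [mul_one] at hc hl
  have key : Real.exp β / (10 * β ^ 3) ≤ (Real.exp β - Real.exp (β * a)) / β -
      (Real.exp β + Real.exp (β * a)) / (β + 1 / (4 * β)) := by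
    have e : (Real.exp β - Real.exp (β * a)) / β -
      (Real.exp β + Real.exp (β * a)) / (β + 1 / (4 * β)) =
      (Real.exp β - Real.exp (β * a) * (8 * β ^ 2 + 1)) / (β * (4 * β ^ 2 + 1)) := by
      field_simp; ring
    rw [e, div_le_div_iff₀ (by positivity) (by positivity)]
    have hb2 : 1 ≤ β ^ 2 := one_le_pow₀ hβ
    have hA : Real.exp (β * a) * (8 * β ^ 2 + 1) ≤ Real.exp β / 2 := by
      nlinarith [Real.exp_pos (β * a)]
    calc _ = β * (Real.exp β * (4 * β ^ 2 + 1)) := by ring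
      _ ≤ β * (Real.exp β * (5 * β ^ 2)) := by gcongr; linarith
      _ = (Real.exp β - Real.exp β / 2) * (10 * β ^ 3) := by ring
      _ ≤ _ := by gcongr
  have : ε * (Real.exp β / (10 * β ^ 3)) ≤ tiltedMoment (levyMeasure G) 0 β -
      (complexMGF id (levyMeasure G) (β + t * Complex.I)).re :=
    le_trans (mul_le_mul_of_nonneg_left (key.trans (sub_le_sub_left hc _)) hε.le) hl
  have e : ε / 10 * Real.exp β / β ^ 3 = ε * (Real.exp β / (10 * β ^ 3)) := by field_simp
  rw [e]; linarith

open scoped FourierTransform in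
theorem complexMGF_eq_fourier (β t : ℝ) : complexMGF id (levyMeasure G) (β + t * Complex.I) =
    𝓕 (fun x : ℝ => G x • Complex.exp (β * x)) ((-(2 * Real.pi)⁻¹) * t) := by
  rw [complexMGF, h.integral_levyMeasure, Real.fourier_real_eq_integral_exp_smul]
  refine integral_congr_ae (.of_forall fun x => ?_)
  simp only [id, smul_eq_mul, Complex.real_smul]
  rw [mul_left_comm, ← Complex.exp_add]
  congr 2
  push_cast
  have : (Real.pi : ℂ) ≠ 0 := Complex.ofReal_ne_zero.2 Real.pi_ne_zero
  field_simp
  ring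

open scoped FourierTransform in
theorem integral_sq_complexMGF (β : ℝ) :
    Integrable (fun t : ℝ => ‖complexMGF id (levyMeasure G) (β + t * Complex.I)‖ ^ 2) ∧
    (0 ≤ β → ∫ t : ℝ, ‖complexMGF id (levyMeasure G) (β + t * Complex.I)‖ ^ 2 ≤
      2 * Real.pi * M ^ 2 * Real.exp (2 * β)) := by
  set f : ℝ → ℂ := fun x : ℝ => G x • Complex.exp (β * x)
  have h1 : Integrable f := h.integrable_mul (by fun_prop)
  have hn (x : ℝ) : ‖f x‖ ^ 2 = G x ^ 2 * Real.exp (2 * β * x) := by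
    rw [norm_smul, Real.norm_of_nonneg (h.nonneg x), mul_pow, Complex.norm_exp,
      ← Real.exp_nat_mul]
    simp [mul_assoc]
  have hle (x : ℝ) : ‖f x‖ ^ 2 ≤ M * (G x • Real.exp (2 * β * x)) := by
    rw [hn, sq, smul_eq_mul, mul_assoc]
    exact mul_le_mul_of_nonneg_right (h.le x) (mul_nonneg (h.nonneg x) (Real.exp_pos _).le)
  have hi : Integrable fun x => M * (G x • Real.exp (2 * β * x)) :=
    (h.integrable_mul (by fun_prop)).const_mul M
  have h2 : MemLp f 2 := (memLp_two_iff_integrable_sq_norm h1.1).2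
    (hi.mono' (h1.1.norm.pow 2) (.of_forall fun x => by
      rw [Real.norm_of_nonneg (by positivity)]; exact hle x))
  obtain ⟨i, e⟩ := integral_sq_norm_fourier h1 h2
  have hpi : -(2 * Real.pi)⁻¹ ≠ 0 := neg_ne_zero.2 (inv_ne_zero (by positivity))
  simp only [h.complexMGF_eq_fourier]
  refine ⟨i.comp_mul_left' hpi, fun hβ => ?_⟩
  rw [Measure.integral_comp_mul_left (fun t => ‖𝓕 f t‖ ^ 2), e, inv_neg, inv_inv, abs_neg,
    abs_of_pos (by positivity), smul_eq_mul, mul_assoc (2 * Real.pi)]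
  gcongr
  have hind : Integrable ((Ioo (0 : ℝ) 1).indicator fun _ => M ^ 2 * Real.exp (2 * β)) :=
    (integrable_indicator_iff measurableSet_Ioo).2 (integrableOn_const (by simp))
  refine (integral_mono ((memLp_two_iff_integrable_sq_norm h1.1).1 h2) hind fun x => ?_).trans
    (le_of_eq ?_)
  · dsimp only
    rw [hn]
    by_cases hx : x ∈ Ioo (0 : ℝ) 1
    · rw [indicator_of_mem hx]
      have h3 := h.le x
      have h4 := h.nonneg x
      exact mul_le_mul (pow_le_pow_left₀ h4 h3 2) (Real.exp_le_exp.2 (by nlinarith [hx.2]))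
        (Real.exp_pos _).le (sq_nonneg M)
    · rw [indicator_of_notMem hx, h.support x hx]; simp
  · rw [integral_indicator measurableSet_Ioo]; simp

theorem saddleRegular : SaddleRegular (levyMeasure G) (ε / 10) (2 * Real.pi * M ^ 2) where
  unit := h.ae_unit
  pos := by have := h.pos; positivity
  moment_ge := h.moment_ge
  integrable_sq β := (h.integral_sq_complexMGF β).1
  integral_sq_le β := (h.integral_sq_complexMGF β).2
  re_le := h.re_le

end UnitLevyDensity

/-! ### Laplace transforms and compound Poisson laws. -/

theorem eq_of_eq_on_real {f g : ℂ → ℂ} (hf : Differentiable ℂ f) (hg : Differentiable ℂ g)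
    (h : ∀ x : ℝ, f x = g x) : f = g := by
  have hf' : AnalyticOnNhd ℂ f univ := fun z _ => hf.analyticAt z
  have hg' : AnalyticOnNhd ℂ g univ := fun z _ => hg.analyticAt z
  refine hf'.eq_of_frequently_eq (z₀ := 0) hg' ?_
  have ht : Tendsto (fun x : ℝ => (x : ℂ)) (𝓝[≠] 0) (𝓝[≠] 0) := by
    refine tendsto_nhdsWithin_iff.2 ⟨?_, ?_⟩
    · exact (Complex.continuous_ofReal.tendsto' 0 0 rfl).mono_left nhdsWithin_le_nhds
    · filter_upwards [self_mem_nhdsWithin] with x hx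
      simpa using hx
  exact ht.frequently (Eventually.of_forall h).frequently

theorem differentiable_complexMGF {μ : Measure ℝ}
    (h : ∀ θ : ℝ, Integrable (fun x => Real.exp (θ * x)) μ) :
    Differentiable ℂ (complexMGF id μ) := fun z =>
  (analyticAt_complexMGF (by
    rw [eq_univ_of_forall (s := integrableExpSet id μ) h, interior_univ]
    trivial)).differentiableAt

/-- Laplace transforms finite on the whole line extend to entire functions, so agreement on the
reals is agreement on the plane, which determines the measure. -/
theorem measure_ext_of_lintegral_exp {μ μ' : Measure ℝ}
    (hfin : ∀ θ : ℝ, ∫⁻ x, ENNReal.ofReal (Real.exp (θ * x)) ∂μ ≠ ⊤)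
    (h : ∀ θ : ℝ, ∫⁻ x, ENNReal.ofReal (Real.exp (θ * x)) ∂μ =
      ∫⁻ x, ENNReal.ofReal (Real.exp (θ * x)) ∂μ') : μ = μ' := by
  have hi {κ : Measure ℝ} (hκ : ∀ θ : ℝ, ∫⁻ x, ENNReal.ofReal (Real.exp (θ * x)) ∂κ ≠ ⊤) (θ : ℝ) :
      Integrable (fun x => Real.exp (θ * x)) κ := by
    refine ⟨by fun_prop, ?_⟩
    rw [hasFiniteIntegral_iff_ofReal (.of_forall fun x => (Real.exp_pos _).le)]
    exact (hκ θ).lt_top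
  have hf {κ : Measure ℝ} (hκ : ∀ θ : ℝ, ∫⁻ x, ENNReal.ofReal (Real.exp (θ * x)) ∂κ ≠ ⊤) :
      IsFiniteMeasure κ := ⟨by simpa using (hκ 0).lt_top⟩
  have hfin' := hfin
  simp only [h] at hfin'
  have := hf hfin
  have := hf hfin'
  refine Measure.ext_of_complexMGF_id_eq (eq_of_eq_on_real
    (differentiable_complexMGF (hi hfin)) (differentiable_complexMGF (hi hfin')) fun θ => ?_)
  rw [complexMGF_ofReal, complexMGF_ofReal]
  congr 1
  simp only [mgf, id]
  rw [integral_eq_lintegral_of_nonneg_ae (.of_forall fun x => (Real.exp_pos _).le) (by fun_prop),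
    integral_eq_lintegral_of_nonneg_ae (.of_forall fun x => (Real.exp_pos _).le) (by fun_prop), h]

/-- `μ` has all exponential moments and Laplace transform `exp ∫ (e^{θx} - 1) ν(dx)`. -/
structure IsCompoundPoisson (μ ν : Measure ℝ) : Prop where
  integrable_exp : ∀ θ : ℝ, Integrable (fun x => Real.exp (θ * x)) μ
  mgf_eq : ∀ θ : ℝ, mgf id μ θ = Real.exp (tiltedMoment ν 0 θ - tiltedMoment ν 0 0)

theorem hasDerivAt_tiltedMoment {ν : Measure ℝ} [IsFiniteMeasure ν]
    (hν : ∀ᵐ x ∂ν, x ∈ Ioo (0 : ℝ) 1) (n : ℕ) (θ : ℝ) :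
    HasDerivAt (tiltedMoment ν n) (tiltedMoment ν (n + 1) θ) θ := by
  refine hasDerivAt_integral_pow_mul_exp_real (X := id) ?_ n
  rw [eq_univ_of_forall (s := integrableExpSet id ν)
    fun t => integrable_of_continuous_unit hν (by simp only [id]; fun_prop), interior_univ]
  trivial

namespace IsCompoundPoisson

variable {μ ν : Measure ℝ} [IsProbabilityMeasure μ] [IsFiniteMeasure ν]
  (h : IsCompoundPoisson μ ν) (hν : ∀ᵐ x ∂ν, x ∈ Ioo (0 : ℝ) 1)
include h hν

omit [IsProbabilityMeasure μ] in
theorem complexMGF_eq (z : ℂ) :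
    complexMGF id μ z = Complex.exp (complexMGF id ν z - tiltedMoment ν 0 0) := by
  have hd : Differentiable ℂ (complexMGF id ν) :=
    differentiable_complexMGF fun t => integrable_of_continuous_unit hν (by fun_prop)
  refine congrFun (eq_of_eq_on_real (differentiable_complexMGF h.integrable_exp)
    (g := fun z => Complex.exp (complexMGF id ν z - tiltedMoment ν 0 0)) (by fun_prop)
    fun x => ?_) z
  rw [complexMGF_ofReal, h.mgf_eq, complexMGF_id_ofReal]
  push_cast; rfl

/-- The Laplace transform at `-n` is at most `1`, so Chernoff bounds the mass of `(-∞, -δ]` by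
`e^{-nδ}` for every `n`. -/
theorem ae_nonneg : ∀ᵐ x ∂μ, 0 ≤ x := by
  have hle (δ : ℝ) (hδ : 0 < δ) : μ.real {x | x ≤ -δ} = 0 := by
    have hb (n : ℕ) : μ.real {x | x ≤ -δ} ≤ Real.exp (-δ) ^ n := by
      have hc := measure_le_le_exp_mul_mgf (X := id) (μ := μ) (t := -(n : ℝ)) (-δ) (by simp)
        (h.integrable_exp _)
      refine hc.trans ?_
      rw [h.mgf_eq, ← Real.exp_add, ← Real.exp_nat_mul]
      refine Real.exp_le_exp.2 ?_
      have : tiltedMoment ν 0 (-(n : ℝ)) ≤ tiltedMoment ν 0 0 := by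
        refine integral_mono_ae (integrable_tilted hν _ _) (integrable_tilted hν _ _)
          (hν.mono fun x hx => ?_)
        have : 0 ≤ (n : ℝ) * x := mul_nonneg n.cast_nonneg hx.1.le
        simpa using this
      linarith
    refine le_antisymm (ge_of_tendsto' (tendsto_pow_atTop_nhds_zero_of_lt_one
      (Real.exp_pos _).le (by simpa using hδ)) hb) measureReal_nonneg
  have hz (n : ℕ) : ∀ᵐ x ∂μ, ¬ x ≤ -(1 / ((n : ℝ) + 1)) := by
    rw [ae_iff]
    simpa using (measureReal_eq_zero_iff (by finiteness)).1 (hle (1 / ((n : ℝ) + 1)) (by positivity))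
  filter_upwards [ae_all_iff.2 hz] with x hx
  by_contra hneg
  obtain ⟨n, hn⟩ := exists_nat_one_div_lt (neg_pos.2 (not_le.1 hneg))
  exact hx n (by linarith)

/-- As `n → ∞`, `e^{-nx}` tends to the indicator of `0` on `[0, ∞)`, and to `0` for `ν`-almost every
`x`; both passages are by dominated convergence. -/
theorem measureReal_zero : μ.real {0} = Real.exp (-tiltedMoment ν 0 0) := by
  have h1 : Tendsto (fun n : ℕ => mgf id μ (-(n : ℝ))) atTop (𝓝 (μ.real {0})) := by
    have e : μ.real {0} = ∫ x, ({0} : Set ℝ).indicator 1 x ∂μ := by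
      rw [integral_indicator_one (measurableSet_singleton 0)]
    rw [e]
    refine tendsto_integral_of_dominated_convergence (fun _ => 1) (fun n => by fun_prop)
      (integrable_const _) (fun n => ?_) ?_
    · filter_upwards [h.ae_nonneg hν] with x hx
      rw [Real.norm_of_nonneg (Real.exp_pos _).le]
      exact Real.exp_le_one_iff.2 (by
        have := mul_nonneg n.cast_nonneg (α := ℝ) hx
        simpa using this)
    · filter_upwards [h.ae_nonneg hν] with x hx
      rcases hx.eq_or_lt with rfl | hx
      · simp
      · rw [indicator_of_notMem (by simpa using hx.ne')]
        have : Tendsto (fun n : ℕ => (n : ℝ) * x) atTop atTop :=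
          tendsto_natCast_atTop_atTop.atTop_mul_const hx
        simpa using this
  have h2 : Tendsto (fun n : ℕ => tiltedMoment ν 0 (-(n : ℝ))) atTop (𝓝 0) := by
    rw [← integral_zero ℝ ℝ (μ := ν)]
    refine tendsto_integral_of_dominated_convergence (fun _ => 1) (fun n => by fun_prop)
      (integrable_const _) (fun n => ?_) ?_
    · filter_upwards [hν] with x hx
      rw [pow_zero, one_mul, Real.norm_of_nonneg (Real.exp_pos _).le]
      exact Real.exp_le_one_iff.2 (by
        have := mul_nonneg n.cast_nonneg (α := ℝ) hx.1.le
        simpa using this)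
    · filter_upwards [hν] with x hx
      have : Tendsto (fun n : ℕ => (n : ℝ) * x) atTop atTop :=
        tendsto_natCast_atTop_atTop.atTop_mul_const hx.1
      simpa using this
  have h3 := (Real.continuous_exp.tendsto _).comp (h2.sub_const (tiltedMoment ν 0 0))
  rw [zero_sub] at h3
  refine tendsto_nhds_unique h1 (h3.congr fun n => ?_)
  simp only [Function.comp, h.mgf_eq]

omit [IsProbabilityMeasure μ] in
theorem integral_id_mul_exp (θ : ℝ) : Integrable (fun x => x * Real.exp (θ * x)) μ ∧
    ∫ x, x * Real.exp (θ * x) ∂μ = tiltedMoment ν 1 θ * mgf id μ θ := by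
  have hs : θ ∈ interior (integrableExpSet id μ) := by
    rw [eq_univ_of_forall (s := integrableExpSet id μ) h.integrable_exp, interior_univ]
    trivial
  refine ⟨by simpa using integrable_pow_mul_exp_of_mem_interior_integrableExpSet hs 1, ?_⟩
  have h1 := hasDerivAt_mgf hs
  have h2 := ((hasDerivAt_tiltedMoment hν 0 θ).sub_const (tiltedMoment ν 0 0)).exp
  rw [funext h.mgf_eq] at h1
  rw [h.mgf_eq, mul_comm]
  exact h1.unique h2

end IsCompoundPoisson

/-! ### Existence of the density by size-biasing. -/

namespace UnitLevyDensity

variable {G : ℝ → ℝ} {S : Set ℝ} {M ε a : ℝ} (h : UnitLevyDensity G S M ε a)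
include h

theorem kernel_nonneg (x : ℝ) : 0 ≤ x * G x := by
  by_cases hx : x ∈ Ioo (0 : ℝ) 1
  · exact mul_nonneg hx.1.le (h.nonneg x)
  · rw [h.support x hx, mul_zero]

theorem kernel_le (x : ℝ) : x * G x ≤ M := by
  by_cases hx : x ∈ Ioo (0 : ℝ) 1
  · exact (mul_le_of_le_one_left (h.nonneg x) hx.2.le).trans (h.le x)
  · rw [h.support x hx, mul_zero]; exact h.bound_nonneg

variable {μ : Measure ℝ} [IsProbabilityMeasure μ]

theorem integrable_kernel_sub (x : ℝ) : Integrable (fun y => (x - y) * G (x - y)) μ := by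
  have := h.measurable
  refine Integrable.of_bound (by fun_prop) M (.of_forall fun y => ?_)
  rw [Real.norm_of_nonneg (h.kernel_nonneg _)]
  exact h.kernel_le _

theorem lintegral_kernel_sub (x : ℝ) :
    ∫⁻ y, ENNReal.ofReal ((x - y) * G (x - y)) ∂μ =
      ENNReal.ofReal (∫ y, (x - y) * G (x - y) ∂μ) :=
  (ofReal_integral_eq_lintegral_ofReal (h.integrable_kernel_sub x)
    (.of_forall fun _ => h.kernel_nonneg _)).symm

/-- The size-biased law is the convolution of the law with `x G(x) dx`. -/
theorem withDensity_id_eq (hμ : IsCompoundPoisson μ (levyMeasure G)) :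
    μ.withDensity (fun x => ENNReal.ofReal x) =
      volume.withDensity fun x => ∫⁻ y, ENNReal.ofReal ((x - y) * G (x - y)) ∂μ := by
  have := h.isFiniteMeasure
  have hGm := h.measurable
  have hpos := hμ.ae_nonneg h.ae_unit
  have hk : Measurable fun p : ℝ × ℝ => ENNReal.ofReal ((p.1 - p.2) * G (p.1 - p.2)) := by fun_prop
  have hA (θ : ℝ) : ∫⁻ x, ENNReal.ofReal (Real.exp (θ * x))
      ∂(μ.withDensity fun x => ENNReal.ofReal x) =
      ENNReal.ofReal (tiltedMoment (levyMeasure G) 1 θ * mgf id μ θ) := by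
    obtain ⟨hi, he⟩ := hμ.integral_id_mul_exp h.ae_unit θ
    rw [← he, ofReal_integral_eq_lintegral_ofReal hi
      (hpos.mono fun x hx => mul_nonneg hx (Real.exp_pos _).le),
      lintegral_withDensity_eq_lintegral_mul _ (by fun_prop) (by fun_prop)]
    refine lintegral_congr_ae (hpos.mono fun x hx => ?_)
    simp only [Pi.mul_apply]
    rw [ENNReal.ofReal_mul hx]
  -- The derivative of `e^{m_0(θ) - m_0(0)}` is `m_1(θ)` times itself, and a product of Laplace
  -- transforms is the transform of a convolution.
  refine measure_ext_of_lintegral_exp (fun θ => ?_) fun θ => ?_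
  · rw [hA]; exact ENNReal.ofReal_ne_top
  rw [hA, lintegral_withDensity_eq_lintegral_mul _ hk.lintegral_prod_right' (by fun_prop)]
  have hm1 : ENNReal.ofReal (tiltedMoment (levyMeasure G) 1 θ) =
      ∫⁻ x, ENNReal.ofReal (Real.exp (θ * x)) * ENNReal.ofReal (x * G x) := by
    rw [tiltedMoment, h.integral_levyMeasure, ofReal_integral_eq_lintegral_ofReal
      (h.integrable_mul (by fun_prop)) (.of_forall fun x => ?_)]
    · refine lintegral_congr fun x => ?_
      rw [← ENNReal.ofReal_mul (Real.exp_pos _).le]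
      congr 1; simp only [smul_eq_mul]; ring
    · have := mul_nonneg (h.kernel_nonneg x) (Real.exp_pos (θ * x)).le
      simp only [smul_eq_mul, Pi.zero_apply]; linarith
  have hm0 : ENNReal.ofReal (mgf id μ θ) = ∫⁻ y, ENNReal.ofReal (Real.exp (θ * y)) ∂μ :=
    ofReal_integral_eq_lintegral_ofReal (hμ.integrable_exp θ)
      (.of_forall fun x => (Real.exp_pos _).le)
  rw [ENNReal.ofReal_mul (tiltedMoment_nonneg h.ae_unit _ _), hm0,
    ← lintegral_const_mul _ (by fun_prop)]
  simp only [Pi.mul_apply]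
  have e1 : ∀ x, (∫⁻ y, ENNReal.ofReal ((x - y) * G (x - y)) ∂μ) *
      ENNReal.ofReal (Real.exp (θ * x)) = ∫⁻ y, ENNReal.ofReal (Real.exp (θ * x)) *
        ENNReal.ofReal ((x - y) * G (x - y)) ∂μ := fun x => by
    rw [mul_comm, lintegral_const_mul _ (by fun_prop)]
  simp only [e1]
  rw [lintegral_lintegral_swap (by fun_prop)]
  refine lintegral_congr fun y => ?_
  rw [hm1, mul_comm, ← lintegral_const_mul _ (by fun_prop),
    ← lintegral_sub_right_eq_self _ y]
  refine lintegral_congr fun x => ?_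
  rw [← mul_assoc, ← ENNReal.ofReal_mul (Real.exp_pos _).le, ← Real.exp_add]
  ring_nf

/-- The density of the absolutely continuous part, from the size-biasing identity. -/
noncomputable def density (G : ℝ → ℝ) (μ : Measure ℝ) : ℝ → ℝ :=
  (Ioi 0).indicator fun x => x⁻¹ * ∫ y, (x - y) * G (x - y) ∂μ

theorem measurable_density : Measurable (density G μ) := by
  have := h.measurable
  refine Measurable.indicator (measurable_inv.mul ?_) measurableSet_Ioi
  have hm : StronglyMeasurable fun p : ℝ × ℝ => (p.1 - p.2) * G (p.1 - p.2) :=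
    (by fun_prop : Measurable _).stronglyMeasurable
  exact hm.integral_prod_right.measurable

omit [IsProbabilityMeasure μ] in
theorem density_nonneg (x : ℝ) : 0 ≤ density G μ x :=
  indicator_nonneg (fun _ hx => mul_nonneg (inv_nonneg.2 (mem_Ioi.1 hx).le)
    (integral_nonneg fun _ => h.kernel_nonneg _)) x

/-- Off `0` the size-biased identity may be divided by `x`; size-biasing loses exactly the mass at
`0`, which is the atom. -/
theorem law_eq (hμ : IsCompoundPoisson μ (levyMeasure G)) :
    μ = μ {0} • Measure.dirac (0 : ℝ) +
      volume.withDensity fun x => ENNReal.ofReal (density G μ x) := by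
  have := h.isFiniteMeasure
  have hGm := h.measurable
  have hpos := hμ.ae_nonneg h.ae_unit
  have hk : Measurable fun p : ℝ × ℝ => ENNReal.ofReal ((p.1 - p.2) * G (p.1 - p.2)) := by fun_prop
  have hr := hk.lintegral_prod_right' (ν := μ)
  have hIoi : μ.restrict {0}ᶜ = μ.restrict (Ioi 0) := by
    refine Measure.restrict_congr_set ?_
    filter_upwards [hpos] with x hx
    exact propext ⟨fun h0 => lt_of_le_of_ne hx (Ne.symm h0), fun h0 => (ne_of_gt h0 : x ≠ 0)⟩
  have h1 := congrArg (fun κ => (Measure.restrict κ (Ioi 0)).withDensity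
    fun x => (ENNReal.ofReal x)⁻¹) (h.withDensity_id_eq hμ)
  rw [restrict_withDensity measurableSet_Ioi, restrict_withDensity measurableSet_Ioi,
    withDensity_inv_same (by fun_prop) ?_ (by simp), ← withDensity_mul _ hr (by fun_prop),
    ← withDensity_indicator measurableSet_Ioi] at h1
  · have h2 : (Ioi (0 : ℝ)).indicator ((fun x => ∫⁻ y, ENNReal.ofReal ((x - y) * G (x - y)) ∂μ) *
        fun x => (ENNReal.ofReal x)⁻¹) = fun x => ENNReal.ofReal (density G μ x) := by
      funext x
      by_cases hx : x ∈ Ioi (0 : ℝ)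
      · rw [density, indicator_of_mem hx, indicator_of_mem hx,
          ENNReal.ofReal_mul (inv_nonneg.2 (mem_Ioi.1 hx).le), ENNReal.ofReal_inv_of_pos hx, mul_comm,
          ← h.lintegral_kernel_sub]
        rfl
      · rw [density, indicator_of_notMem hx, indicator_of_notMem hx, ENNReal.ofReal_zero]
    rw [h2] at h1
    rw [← h1, ← hIoi, ← Measure.restrict_singleton,
      Measure.restrict_add_restrict_compl (measurableSet_singleton 0)]
  · filter_upwards [self_mem_ae_restrict measurableSet_Ioi] with x hx
    simpa using hx

theorem measure_singleton_eq_zero (hμ : IsCompoundPoisson μ (levyMeasure G)) {x : ℝ}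
    (hx : x ≠ 0) : μ {x} = 0 := by
  rw [h.law_eq hμ, Measure.add_apply, Measure.smul_apply,
    Measure.dirac_apply' _ (measurableSet_singleton x),
    indicator_of_notMem (by simpa using hx.symm), smul_zero, zero_add,
    withDensity_absolutelyContinuous _ _ (measure_singleton x)]

/-- Dominated convergence: continuity of the integrand at `x` can fail only for `y` in the finite
set `x - S`. As `S ⊆ [0, 1]` and `x > 1`, that set misses `0`, the only possible atom of `μ`. -/
theorem continuousOn_density (hμ : IsCompoundPoisson μ (levyMeasure G)) :
    ContinuousOn (density G μ) (Ioi 1) := by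
  have hGm := h.measurable
  refine continuousOn_of_forall_continuousAt fun x hx => ?_
  have hx1 : 1 < x := hx
  have hx0 : 0 < x := by linarith
  have hc : ContinuousAt (fun x => ∫ y, (x - y) * G (x - y) ∂μ) x := by
    refine continuousAt_of_dominated (bound := fun _ => M) (.of_forall fun z => by fun_prop)
      (.of_forall fun z => .of_forall fun y => ?_) (integrable_const _) ?_
    · rw [Real.norm_of_nonneg (h.kernel_nonneg _)]
      exact h.kernel_le _
    · have hS : μ ((fun s => x - s) '' S) = 0 := by
        refine (measure_null_iff_singleton (h.finite.image _).countable).2 ?_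
        rintro _ ⟨s, hs, rfl⟩
        exact h.measure_singleton_eq_zero hμ (by dsimp only; linarith [(h.subset hs).2])
      filter_upwards [measure_eq_zero_iff_ae_notMem.1 hS] with y hy
      have hyS : x - y ∉ S := fun hs => hy ⟨x - y, hs, by simp⟩
      have hsub : ContinuousAt (fun z : ℝ => z - y) x := by fun_prop
      exact hsub.mul (ContinuousAt.comp (f := fun z : ℝ => z - y) (h.continuousAt _ hyS) hsub)
  refine ((continuousAt_inv₀ hx0.ne').mul hc).congr ?_
  filter_upwards [lt_mem_nhds hx0] with z hz
  rw [density, indicator_of_mem (mem_Ioi.2 hz)]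
  rfl

end UnitLevyDensity

/-! ### Fourier inversion of the tilted density. -/

/-- `f` is the density of `μ` off its atom at `0`, continuous on `(1, ∞)`. -/
structure IsOffAtomDensity (μ : Measure ℝ) (f : ℝ → ℝ) : Prop where
  measurable : Measurable f
  nonneg : ∀ x, 0 ≤ f x
  law_eq : μ = μ {0} • Measure.dirac (0 : ℝ) + volume.withDensity fun x => ENNReal.ofReal (f x)
  continuousOn : ContinuousOn f (Ioi 1)

namespace IsOffAtomDensity

variable {μ : Measure ℝ} [IsProbabilityMeasure μ] {f : ℝ → ℝ} (hf : IsOffAtomDensity μ f)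
include hf

omit [IsProbabilityMeasure μ] in
theorem integrable_mul {φ : ℝ → ℂ} (hφ : Integrable φ μ) : Integrable fun x => (f x : ℂ) * φ x := by
  have := hf.measurable
  rw [hf.law_eq] at hφ
  have h2 := hφ.right_of_add_measure
  rw [integrable_withDensity_iff_integrable_smul' (by fun_prop) (by simp)] at h2
  refine h2.congr (.of_forall fun x => ?_)
  simp only [ENNReal.toReal_ofReal (hf.nonneg x), Complex.real_smul]

omit [IsProbabilityMeasure μ] in
theorem integral_eq {φ : ℝ → ℂ} (hφ : Integrable φ μ) :
    ∫ x, φ x ∂μ = μ.real {0} * φ 0 + ∫ x, (f x : ℂ) * φ x := by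
  have := hf.measurable
  have hφ' := hφ
  rw [hf.law_eq] at hφ'
  conv_lhs => rw [hf.law_eq]
  rw [integral_add_measure hφ'.left_of_add_measure hφ'.right_of_add_measure,
    integral_smul_measure, integral_dirac, integral_withDensity_eq_integral_toReal_smul
      (by fun_prop) (by simp), Complex.real_smul]
  refine congrArg₂ _ rfl (integral_congr_ae (.of_forall fun x => ?_))
  simp only [ENNReal.toReal_ofReal (hf.nonneg x), Complex.real_smul]

variable {G : ℝ → ℝ} {S : Set ℝ} {M ε a : ℝ}

open scoped FourierTransform in
/-- Fourier inversion for the exponentially tilted density. -/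
theorem exp_mul_eq_saddleIntegral (h : UnitLevyDensity G S M ε a)
    (hμ : IsCompoundPoisson μ (levyMeasure G)) (β : ℝ) {s : ℝ} (hs : 1 < s) :
    ((Real.exp (β * s) * f s : ℝ) : ℂ) =
      (Real.exp (-tiltedMoment (levyMeasure G) 0 0) / (2 * Real.pi) : ℝ) *
        saddleIntegral (levyMeasure G) β s := by
  have := h.isFiniteMeasure
  set ν := levyMeasure G with hν
  have hp0 := hμ.measureReal_zero h.ae_unit
  set p := Real.exp (-tiltedMoment ν 0 0)
  have hexpi (z : ℂ) : Integrable (fun x : ℝ => Complex.exp (z * x)) μ := by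
    refine (integrable_norm_iff (by fun_prop)).1 ((hμ.integrable_exp z.re).congr
      (.of_forall fun x => ?_))
    simp only [Complex.norm_exp, Complex.re_mul_ofReal]
  -- Removing the single-jump part leaves an integrable transform and changes nothing at `s > 1`,
  -- where `G` vanishes.
  set H : ℝ → ℂ := fun x => f x * Complex.exp (β * x) - p * (G x • Complex.exp (β * x)) with hH
  have hHi : Integrable H :=
    (hf.integrable_mul (hexpi β)).sub ((h.integrable_mul (by fun_prop)).const_mul _)
  have hft (ξ : ℝ) : 𝓕 H ξ = p * poissonRemainder ν β (-(2 * Real.pi) * ξ) := by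
    set z : ℂ := β + (-(2 * Real.pi) * ξ : ℝ) * Complex.I with hz
    have e1 : 𝓕 H ξ = (∫ x : ℝ, (f x : ℂ) * Complex.exp (z * x)) -
        p * ∫ x : ℝ, G x • Complex.exp (z * x) := by
      rw [← integral_const_mul, ← integral_sub (hf.integrable_mul (hexpi z))
        ((h.integrable_mul (by fun_prop)).const_mul _), Real.fourier_real_eq_integral_exp_smul]
      refine integral_congr_ae (.of_forall fun x => ?_)
      have : Complex.exp (z * x) = Complex.exp ((-2 * Real.pi * x * ξ : ℝ) * Complex.I) *
          Complex.exp (β * x) := by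
        rw [← Complex.exp_add, hz]; push_cast; ring_nf
      simp only [hH, this, smul_eq_mul, Complex.real_smul]
      ring
    have e2 := hf.integral_eq (hexpi z)
    have e3 : complexMGF id μ z = ∫ x : ℝ, Complex.exp (z * x) ∂μ := rfl
    have e4 : ∫ x : ℝ, G x • Complex.exp (z * x) = complexMGF id ν z :=
      (h.integral_levyMeasure fun x => Complex.exp (z * x)).symm
    have e5 : Complex.exp (complexMGF id ν z - tiltedMoment ν 0 0) =
        p * Complex.exp (complexMGF id ν z) := by
      rw [sub_eq_neg_add, Complex.exp_add, Complex.ofReal_exp, Complex.ofReal_neg]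
    rw [← e3, hμ.complexMGF_eq h.ae_unit, e5, hp0, Complex.ofReal_zero, mul_zero, Complex.exp_zero,
      mul_one] at e2
    rw [e1, e4, poissonRemainder]
    linear_combination -e2
  have hpi : -(2 * Real.pi) ≠ 0 := neg_ne_zero.2 (by positivity)
  have hftf : 𝓕 H = fun ξ => (p : ℂ) * poissonRemainder ν β (-(2 * Real.pi) * ξ) := funext hft
  have hfti : Integrable (𝓕 H) := by
    rw [hftf]
    exact ((integrable_poissonRemainder h.ae_unit
      (h.integral_sq_complexMGF β).1).comp_mul_left' hpi).const_mul _
  have hGs : ∀ᶠ x in 𝓝 s, H x = f x * Complex.exp (β * x) := by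
    filter_upwards [lt_mem_nhds hs] with x hx
    simp only [hH, h.support x (fun hx' => absurd hx'.2 (not_lt.2 hx.le)), zero_smul, mul_zero,
      sub_zero]
  have hcont : ContinuousAt H s := by
    have hfc : ContinuousAt f s := hf.continuousOn.continuousAt (Ioi_mem_nhds hs)
    have hc : ContinuousAt (fun x : ℝ => (f x : ℂ) * Complex.exp (β * x)) s :=
      (Complex.continuous_ofReal.continuousAt.comp hfc).mul (by fun_prop)
    exact hc.congr (hGs.mono fun x hx => hx.symm)
  have hinv := hHi.fourierInv_fourier_eq hfti hcont
  rw [hGs.self_of_nhds, Real.fourierInv_eq', hftf] at hinv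
  have e : ((Real.exp (β * s) * f s : ℝ) : ℂ) = f s * Complex.exp (β * s) := by push_cast; ring
  rw [e, ← hinv, saddleIntegral]
  have hscale := Measure.integral_comp_mul_left (fun t : ℝ =>
    (p : ℂ) * (Complex.exp (-(s * t : ℝ) * Complex.I) * poissonRemainder ν β t)) (-(2 * Real.pi))
  rw [abs_inv, abs_neg, abs_of_pos (by positivity : 0 < 2 * Real.pi),
    Complex.real_smul] at hscale
  refine Eq.trans (integral_congr_ae (.of_forall fun ξ => ?_)) (hscale.trans ?_)
  · simp only [smul_eq_mul]
    rw [mul_left_comm]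
    congr 3
    simp only [RCLike.inner_apply, conj_trivial]
    push_cast; ring
  · rw [integral_const_mul]; push_cast; ring

end IsOffAtomDensity

/-! ### From the inversion integral to density and tail bounds. -/

theorem integral_exp_neg_bound {β : ℝ} (hβ : 0 < β) (b c : ℝ) (hb : 0 ≤ b) :
    ∃ φ : ℝ → ℝ, IntegrableOn φ (Ioi 0) ∧
      (∀ v ∈ Ioi (0 : ℝ), Real.exp (-β * v) * (b * v + c) ≤ φ v) ∧
      ∫ v in Ioi (0 : ℝ), φ v = 4 * b / β ^ 2 + c / β := by
  have i1 := (integrableOn_exp_mul_Ioi (a := -β / 2) (by linarith) 0).const_mul (b * (2 / β))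
  have i2 := (integrableOn_exp_mul_Ioi (a := -β) (by linarith) 0).const_mul c
  refine ⟨fun v => b * (2 / β) * Real.exp (-β / 2 * v) + c * Real.exp (-β * v), i1.add i2,
    fun v hv => ?_, ?_⟩
  · have hv0 : 0 < v := hv
    have h1 : v ≤ 2 / β * Real.exp (β / 2 * v) := by
      have h2 := (lt_add_one (β / 2 * v)).le.trans (Real.add_one_le_exp (β / 2 * v))
      calc v = 2 / β * (β / 2 * v) := by field_simp
        _ ≤ _ := by gcongr
    have h3 : Real.exp (-β * v) * v ≤ 2 / β * Real.exp (-β / 2 * v) := by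
      calc _ ≤ Real.exp (-β * v) * (2 / β * Real.exp (β / 2 * v)) := by gcongr
        _ = 2 / β * (Real.exp (-β * v) * Real.exp (β / 2 * v)) := by ring
        _ = _ := by rw [← Real.exp_add]; ring_nf
    have := mul_le_mul_of_nonneg_left h3 hb
    linarith
  · rw [integral_add i1 i2, integral_const_mul, integral_const_mul,
      integral_exp_mul_Ioi (by linarith), integral_exp_mul_Ioi (by linarith)]
    simp only [mul_zero, Real.exp_zero]
    field_simp
    ring

namespace IsOffAtomDensity

variable {μ : Measure ℝ} [IsProbabilityMeasure μ] {f : ℝ → ℝ} (hf : IsOffAtomDensity μ f)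
include hf

theorem integrable : Integrable f := by
  have := hf.integrable_mul (integrable_const (1 : ℂ))
  simpa using this.re

omit [IsProbabilityMeasure μ] in
theorem measureReal_Ici {u : ℝ} (hu : 0 < u) :
    μ.real (Ici u) = ∫ v in Ioi (0 : ℝ), f (u + v) := by
  have hfm := hf.measurable
  have h1 : μ (Ici u) = ∫⁻ x in Ici u, ENNReal.ofReal (f x) := by
    conv_lhs => rw [hf.law_eq]
    rw [Measure.add_apply, Measure.smul_apply, Measure.dirac_apply' _ measurableSet_Ici,
      indicator_of_notMem (by simpa using hu), smul_zero, zero_add,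
      withDensity_apply _ measurableSet_Ici]
  have h2 : μ.real (Ici u) = ∫ x in Ici u, f x := by
    rw [Measure.real, h1, integral_eq_lintegral_of_nonneg_ae (.of_forall hf.nonneg) (by fun_prop)]
  rw [h2, integral_Ici_eq_integral_Ioi, ← integral_indicator measurableSet_Ioi,
    ← integral_add_left_eq_self _ u, ← integral_indicator measurableSet_Ioi]
  refine integral_congr_ae (.of_forall fun v => ?_)
  simp only [indicator, mem_Ioi, lt_add_iff_pos_right]

variable {G : ℝ → ℝ} {S : Set ℝ} {M ε a : ℝ}

/-- Saddle point bounds in terms of the tilting parameter. -/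
theorem saddle_bounds (h : UnitLevyDensity G S M ε a)
    (hμ : IsCompoundPoisson μ (levyMeasure G)) :
    ∃ A, 0 ≤ A ∧ ∀ᶠ β : ℝ in atTop, ∀ u W : ℝ, u = tiltedMoment (levyMeasure G) 1 β →
      W = Real.exp (tiltedMoment (levyMeasure G) 0 β - tiltedMoment (levyMeasure G) 0 0 - u * β) /
        (Real.sqrt (2 * Real.pi) * Real.sqrt (tiltedMoment (levyMeasure G) 2 β)) →
      1 ≤ β ∧ 0 < W ∧ |f u - W| ≤ W * (A / u) ∧
        |μ.real (Ici u) - W / β| ≤ W / β * (A / Real.sqrt u) := by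
  have := h.isFiniteMeasure
  obtain ⟨A, hA, hev⟩ := h.saddleRegular.saddleIntegral_asymptotics
  -- `10 = 8 + 1 + 1`, collected in the last lines of the proof: the shift by `v`, the constant
  -- error in it, and the error of `f u` itself.
  refine ⟨10 * A, by positivity, ?_⟩
  filter_upwards [hev, h.saddleRegular.moment_two_ge, eventually_ge_atTop 1,
    h.saddleRegular.tendsto_moment_one.eventually_ge_atTop 2] with β ⟨h1, h2⟩ h24 hβ hu2 u W hu hW
  rw [← hu] at h1 h2 h24 hu2
  set s := tiltedMoment (levyMeasure G) 2 β
  set m := tiltedMoment (levyMeasure G) 0 β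
  set m0 := tiltedMoment (levyMeasure G) 0 0
  have hβ0 : 0 < β := by linarith
  have hs : 0 < s := by linarith
  set r := Real.sqrt s
  have hr : 0 < r := Real.sqrt_pos.2 hs
  set q := Real.sqrt (2 * Real.pi)
  have hq : 0 < q := Real.sqrt_pos.2 (by positivity)
  have hqq : q * q = 2 * Real.pi := Real.mul_self_sqrt (by positivity)
  have hq1 : 1 ≤ q := Real.one_le_sqrt.2 (by linarith [Real.pi_gt_three])
  have hW0 : 0 < W := by rw [hW]; positivity
  have hu0 : 0 < u := by linarith
  set E := Real.exp (m - m0 - u * β) with hE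
  have hE0 : 0 < E := Real.exp_pos _
  have hWE : E = W * (q * r) := by rw [hW]; field_simp
  have hfin : ∀ v : ℝ, 0 ≤ v → ((2 * Real.pi * (f (u + v) * Real.exp (β * v)) / E : ℝ) : ℂ) =
      Real.exp (-m) * saddleIntegral (levyMeasure G) β (u + v) := by
    intro v hv
    have hi : ((Real.exp (β * (u + v)) * f (u + v) : ℝ) : ℂ) =
        (Real.exp (-m0) / (2 * Real.pi) : ℝ) * saddleIntegral (levyMeasure G) β (u + v) :=
      hf.exp_mul_eq_saddleIntegral h hμ β (by linarith)
    have hp : (Real.exp (-m0) / (2 * Real.pi)) ≠ 0 := by positivity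
    have hpc : ((Real.exp (-m0) / (2 * Real.pi) : ℝ) : ℂ) ≠ 0 := Complex.ofReal_ne_zero.2 hp
    refine mul_left_cancel₀ hpc ?_
    rw [mul_left_comm _ (Real.exp (-m) : ℂ), ← hi]
    norm_cast
    have e1 : Real.exp (β * (u + v)) = Real.exp (β * u) * Real.exp (β * v) := by
      rw [← Real.exp_add]; ring_nf
    have e2 : E = Real.exp (-m0) * (Real.exp (-m))⁻¹ * (Real.exp (β * u))⁻¹ := by
      rw [← Real.exp_neg, ← Real.exp_neg, ← Real.exp_add, ← Real.exp_add, hE]; ring_nf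
    rw [e1, e2]
    have := (Real.exp_pos (-m0)).ne'
    have := (Real.exp_pos (-m)).ne'
    have := (Real.exp_pos (β * u)).ne'
    field_simp
  have hsq : Real.sqrt (2 * Real.pi / s) = q / r := Real.sqrt_div (by positivity) s
  have hf0 : |f u - W| ≤ W * (A / u) := by
    have e := hfin 0 le_rfl
    simp only [add_zero, mul_zero, Real.exp_zero, mul_one] at e
    rw [← e, ← Complex.ofReal_sub, Complex.norm_real, Real.norm_eq_abs, hsq, hWE, ← hqq] at h1
    have e2 : q * q * f u / (W * (q * r)) - q / r = q / (W * r) * (f u - W) := by field_simp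
    rw [e2, abs_mul, abs_of_pos (by positivity), ← le_div_iff₀' (by positivity)] at h1
    refine h1.trans ?_
    calc _ = W * (A / u) / q := by field_simp
      _ ≤ _ := div_le_self (by positivity) hq1
  have hfv (v : ℝ) (hv : 0 ≤ v) :
      |f (u + v) * Real.exp (β * v) - f u| ≤ W * A / r * v + W * A / u := by
    have e := hfin 0 le_rfl
    simp only [add_zero, mul_zero, Real.exp_zero, mul_one] at e
    have h3 := h2 v hv
    rw [mul_sub, ← hfin v hv, ← e, ← Complex.ofReal_sub, Complex.norm_real, Real.norm_eq_abs,
      hWE, ← hqq] at h3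
    have e2 : q * q * (f (u + v) * Real.exp (β * v)) / (W * (q * r)) - q * q * f u / (W * (q * r)) =
        q / (W * r) * (f (u + v) * Real.exp (β * v) - f u) := by field_simp
    have hss : s = r * r := (Real.mul_self_sqrt hs.le).symm
    rw [e2, abs_mul, abs_of_pos (by positivity), ← le_div_iff₀' (by positivity), hss] at h3
    refine h3.trans ?_
    calc _ = (W * A / r * v + W * A / u) / q := by field_simp
      _ ≤ _ := div_le_self (by positivity) hq1
  have hsu : Real.sqrt u / 2 ≤ r := by
    have : Real.sqrt (u / 4) = Real.sqrt u / 2 := by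
      rw [Real.sqrt_div hu0.le]; norm_num
    rw [← this]
    exact Real.sqrt_le_sqrt h24
  have hsu0 : 0 < Real.sqrt u := Real.sqrt_pos.2 hu0
  have hsuu : Real.sqrt u ≤ u := Real.sqrt_le_iff.2 ⟨hu0.le, by nlinarith⟩
  have htail : |μ.real (Ici u) - f u / β| ≤ 4 * (W * A / r) / β ^ 2 + W * A / u / β := by
    obtain ⟨φ, i1, i2, i3⟩ := integral_exp_neg_bound hβ0 (W * A / r) (W * A / u) (by positivity)
    have hc : f u / β = ∫ v in Ioi (0 : ℝ), Real.exp (-β * v) * f u := by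
      rw [integral_mul_const, integral_exp_mul_Ioi (by linarith)]
      simp only [mul_zero, Real.exp_zero]; field_simp
    have j1 : IntegrableOn (fun v => f (u + v)) (Ioi 0) := (hf.integrable.comp_add_left u).integrableOn
    have j2 : IntegrableOn (fun v => Real.exp (-β * v) * f u) (Ioi 0) :=
      (integrableOn_exp_mul_Ioi (by linarith) 0).mul_const _
    rw [hf.measureReal_Ici hu0, hc, ← integral_sub j1 j2, ← i3, ← Real.norm_eq_abs]
    refine norm_integral_le_of_norm_le i1 ?_
    filter_upwards [self_mem_ae_restrict measurableSet_Ioi] with v hv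
    refine le_trans ?_ (i2 v hv)
    have e : f (u + v) - Real.exp (-β * v) * f u =
        Real.exp (-β * v) * (f (u + v) * Real.exp (β * v) - f u) := by
      have : Real.exp (-β * v) * Real.exp (β * v) = 1 := by
        rw [← Real.exp_add]; simp
      linear_combination (-f (u + v)) * this
    rw [e, norm_mul, Real.norm_of_nonneg (Real.exp_pos _).le, Real.norm_eq_abs]
    exact mul_le_mul_of_nonneg_left (hfv v (le_of_lt hv)) (Real.exp_pos _).le
  refine ⟨hβ, hW0, hf0.trans (by gcongr; linarith), ?_⟩
  have hA1 : A / u ≤ A / Real.sqrt u := by gcongr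
  -- This term, due to the variation of `f(u + v) e^{βv}` in `v`, sets the rate `1/√u`; the others
  -- are `O(1/u)`.
  have hA2 : 4 * (A / r) / β ≤ 8 * (A / Real.sqrt u) := by
    calc _ ≤ 4 * (A / r) := div_le_self (by positivity) hβ
      _ ≤ 4 * (A / (Real.sqrt u / 2)) := by gcongr
      _ = _ := by field_simp; ring
  have hf1 : |f u / β - W / β| ≤ W / β * (A / u) := by
    rw [← sub_div, abs_div, abs_of_pos hβ0, div_mul_eq_mul_div]
    gcongr
  calc _ ≤ |μ.real (Ici u) - f u / β| + |f u / β - W / β| := abs_sub_le _ _ _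
    _ ≤ 4 * (W * A / r) / β ^ 2 + W * A / u / β + W / β * (A / u) := add_le_add htail hf1
    _ = W / β * (4 * (A / r) / β + A / u + A / u) := by field_simp
    _ ≤ W / β * (8 * (A / Real.sqrt u) + A / Real.sqrt u + A / Real.sqrt u) := by gcongr
    _ = _ := by ring

end IsOffAtomDensity

/-! ### From piecewise smoothness to the properties used. -/

theorem exists_mem_Ioo_of_notMem_range {n : ℕ} {p : Fin (n + 1) → ℝ} {x : ℝ} (h0 : p 0 < x)
    (h1 : x < p (Fin.last n)) (hx : x ∉ range p) :
    ∃ i : Fin n, x ∈ Ioo (p i.castSucc) (p i.succ) := by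
  by_contra! hne
  have hlt (i : Fin (n + 1)) : p i < x := by
    induction i using Fin.induction with
    | zero => exact h0
    | succ i ih =>
      refine lt_of_le_of_ne (not_lt.1 fun hlt => hne i ⟨ih, hlt⟩) fun he => hx ⟨_, he⟩
  exact absurd (hlt (Fin.last n)) (not_lt.2 h1.le)

theorem exists_bound_Ioo {g : ℝ → ℝ} {a b l l' : ℝ} (hc : ContinuousOn g (Ioo a b))
    (ha : Tendsto g (𝓝[>] a) (𝓝 l)) (hb : Tendsto g (𝓝[<] b) (𝓝 l')) :
    ∃ C, ∀ x ∈ Ioo a b, g x ≤ C := by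
  obtain ⟨C, hC⟩ := isCompact_Icc.exists_bound_of_continuousOn
    (continuousOn_Icc_extendFrom_Ioo hc ha hb)
  refine ⟨C, fun x hx => ?_⟩
  have h1 := hC x (Ioo_subset_Icc_self hx)
  rw [extendFrom_eq (subset_closure hx) (hc x hx)] at h1
  exact (le_abs_self _).trans h1

theorem PiecewiseContDiff.unitLevyDensity {k : ℕ} {g : ℝ → ℝ} {ε : ℝ}
    (hg : PiecewiseContDiff k g 0 1) (hg0 : ∀ x ∈ Icc (0 : ℝ) 1, 0 ≤ g x) (hε : 0 < ε)
    (hl : ∀ x ∈ Icc (0 : ℝ) 1, 1 - ε ≤ x → ε ≤ g x) :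
    ∃ S M a, UnitLevyDensity ((Ioo (0 : ℝ) 1).indicator g) S M ε a := by
  obtain ⟨n, p, hp, hp0, hp1, hi⟩ := hg
  have hb (i : Fin n) : ∃ C, ∀ x ∈ Ioo (p i.castSucc) (p i.succ), g x ≤ C := by
    obtain ⟨hc, hlim⟩ := hi i
    obtain ⟨⟨l, h1⟩, ⟨l', h2⟩⟩ := hlim 0 (Nat.zero_le _)
    rw [iteratedDeriv_zero] at h1 h2
    exact exists_bound_Ioo hc.continuousOn h1 h2
  choose C hC using hb
  obtain ⟨D, hD⟩ := ((finite_range p).image g).bddAbove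
  obtain ⟨B, hB⟩ := (finite_range C).bddAbove
  have h0 {x : ℝ} (hx : x ∈ Ioo (0 : ℝ) 1) (hxr : x ∉ range p) :
      ∃ i : Fin n, x ∈ Ioo (p i.castSucc) (p i.succ) :=
    exists_mem_Ioo_of_notMem_range (by rw [hp0]; exact hx.1) (by rw [hp1]; exact hx.2) hxr
  -- `D` bounds `g` at the partition points, `B` on the open pieces, and `0` covers the outside. The
  -- `1/2` keeps `a` inside `(0, 1)` even when `ε ≥ 1`.
  refine ⟨range p, max 0 (max D B), max (1 - ε) (1 / 2), ?_⟩
  refine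
    { finite := finite_range p
      subset := ?_
      continuousAt := fun x hx => ?_
      nonneg := fun x => indicator_nonneg (fun x hx => hg0 x (Ioo_subset_Icc_self hx)) x
      le := fun x => ?_
      support := fun x hx => indicator_of_notMem hx g
      pos := hε
      half_le := le_max_right _ _
      lt_one := max_lt (by linarith) (by norm_num)
      lower := fun x hx => ?_ }
  · rintro _ ⟨i, rfl⟩
    exact ⟨hp0 ▸ hp.monotone (Fin.zero_le i), hp1 ▸ hp.monotone (Fin.le_last i)⟩
  · by_cases hx1 : x ∈ Ioo (0 : ℝ) 1
    · obtain ⟨i, hxi⟩ := h0 hx1 hx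
      refine ((hi i).1.continuousOn.continuousAt (Ioo_mem_nhds hxi.1 hxi.2)).congr ?_
      filter_upwards [Ioo_mem_nhds hx1.1 hx1.2] with y hy
      rw [indicator_of_mem hy]
    · have hx2 : x ∉ Icc (0 : ℝ) 1 := fun hx3 => by
        rcases hx3.1.eq_or_lt with h | h
        · exact hx ⟨0, hp0.trans h⟩
        · rcases hx3.2.eq_or_lt with h' | h'
          · exact hx ⟨Fin.last n, hp1.trans h'.symm⟩
          · exact hx1 ⟨h, h'⟩
      refine continuousAt_const (y := (0 : ℝ)) |>.congr ?_
      filter_upwards [isClosed_Icc.isOpen_compl.mem_nhds hx2] with y hy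
      rw [indicator_of_notMem fun hy' => hy (Ioo_subset_Icc_self hy')]
  · by_cases hx1 : x ∈ Ioo (0 : ℝ) 1
    · rw [indicator_of_mem hx1]
      by_cases hxr : x ∈ range p
      · exact (hD ⟨x, hxr, rfl⟩).trans ((le_max_left _ _).trans (le_max_right _ _))
      · obtain ⟨i, hxi⟩ := h0 hx1 hxr
        exact (hC i x hxi).trans
          ((hB ⟨i, rfl⟩).trans ((le_max_right _ _).trans (le_max_right _ _)))
    · rw [indicator_of_notMem hx1]; exact le_max_left _ _
  · have h1 := (le_max_left _ _).trans hx.1.le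
    have h2 := (le_max_right _ _).trans hx.1.le
    have h3 : x ∈ Ioo (0 : ℝ) 1 := ⟨by linarith, hx.2⟩
    rw [indicator_of_mem h3]
    exact hl x (Ioo_subset_Icc_self h3) h1

/-! ### The cumulant and the saddle point equation. -/

namespace UnitLevyDensity

theorem levyCumulant_eq {g : ℝ → ℝ} {S : Set ℝ} {M ε a : ℝ}
    (h : UnitLevyDensity ((Ioo (0 : ℝ) 1).indicator g) S M ε a) :
    levyCumulant g = fun θ => tiltedMoment (levyMeasure ((Ioo (0 : ℝ) 1).indicator g)) 0 θ -
      tiltedMoment (levyMeasure ((Ioo (0 : ℝ) 1).indicator g)) 0 0 := by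
  funext θ
  rw [tiltedMoment, tiltedMoment, h.integral_levyMeasure, h.integral_levyMeasure,
    ← integral_sub (h.integrable_mul (by fun_prop)) (h.integrable_mul (by fun_prop)), levyCumulant,
    intervalIntegral.integral_of_le zero_le_one, integral_Ioc_eq_integral_Ioo,
    ← integral_indicator measurableSet_Ioo]
  refine integral_congr_ae (.of_forall fun x => ?_)
  by_cases hx : x ∈ Ioo (0 : ℝ) 1
  · simp only [indicator_of_mem hx, smul_eq_mul, pow_zero, one_mul, zero_mul, Real.exp_zero]
    ring
  · simp only [indicator_of_notMem hx, zero_smul, sub_zero]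

variable {G : ℝ → ℝ} {S : Set ℝ} {M ε a : ℝ} (h : UnitLevyDensity G S M ε a)
include h

theorem tiltedMoment_pos (n : ℕ) (θ : ℝ) : 0 < tiltedMoment (levyMeasure G) n θ := by
  have ha := h.half_le
  refine lt_of_lt_of_le (mul_pos h.pos ?_) (h.le_integral_levyMeasure
    (φ := fun x => x ^ n * Real.exp (θ * x)) (by fun_prop) fun x hx => by positivity)
  refine intervalIntegral.intervalIntegral_pos_of_pos_on
    ((by fun_prop : Continuous _).intervalIntegrable _ _) (fun x hx => ?_) h.lt_one
  have : 0 < x := by linarith [hx.1]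
  positivity

theorem strictMono_tiltedMoment_one : StrictMono (tiltedMoment (levyMeasure G) 1) := by
  have := h.isFiniteMeasure
  refine strictMono_of_deriv_pos fun θ => ?_
  rw [(hasDerivAt_tiltedMoment h.ae_unit 1 θ).deriv]
  exact h.tiltedMoment_pos 2 θ

theorem exists_tiltedMoment_one_eq {u : ℝ} (hu : 0 < u) :
    ∃ θ, tiltedMoment (levyMeasure G) 1 θ = u := by
  have := h.isFiniteMeasure
  have hc : Continuous (tiltedMoment (levyMeasure G) 1) := continuous_iff_continuousAt.2 fun θ =>
    (hasDerivAt_tiltedMoment h.ae_unit 1 θ).continuousAt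
  refine mem_range_of_exists_le_of_exists_ge hc ?_
    (h.saddleRegular.tendsto_moment_one.eventually_ge_atTop u).exists
  set Λ := (levyMeasure G).real univ
  have hΛ : 0 ≤ Λ := measureReal_nonneg
  -- With `κ = (Λ + 1)/u`, `x e^{-κx} ≤ 1/κ`; integrating over total mass `Λ` gives at most `u`.
  refine ⟨-((Λ + 1) / u), ?_⟩
  have hb : tiltedMoment (levyMeasure G) 1 (-((Λ + 1) / u)) ≤ ∫ _, u / (Λ + 1) ∂levyMeasure G := by
    refine integral_mono_ae (integrable_tilted h.ae_unit 1 _) (integrable_const _)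
      (h.ae_unit.mono fun x hx => ?_)
    have h1 := (lt_add_one ((Λ + 1) / u * x)).le.trans (Real.add_one_le_exp ((Λ + 1) / u * x))
    simp only [pow_one]
    rw [neg_mul, Real.exp_neg, ← div_eq_mul_inv, div_le_iff₀ (Real.exp_pos _)]
    calc x = u / (Λ + 1) * ((Λ + 1) / u * x) := by field_simp
      _ ≤ _ := by gcongr
  refine hb.trans ?_
  rw [integral_const, smul_eq_mul, mul_div_assoc', div_le_iff₀ (by positivity)]
  change Λ * u ≤ _
  nlinarith

end UnitLevyDensity

theorem HasLevyDensity.isCompoundPoisson {Ω : Type*} [MeasurableSpace Ω] {P : Measure Ω}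
    [IsProbabilityMeasure P] {T : Ω → ℝ} (hT : AEMeasurable T P) {g : ℝ → ℝ} {S : Set ℝ}
    {M ε a : ℝ} (h : UnitLevyDensity ((Ioo (0 : ℝ) 1).indicator g) S M ε a)
    (hTg : HasLevyDensity T P g) :
    IsCompoundPoisson (P.map T) (levyMeasure ((Ioo (0 : ℝ) 1).indicator g)) where
  integrable_exp θ := (integrable_map_measure (by fun_prop) hT).2 (hTg θ).1
  mgf_eq θ := by
    rw [mgf_id_map hT, ← exp_cgf (hTg θ).1, (hTg θ).2, h.levyCumulant_eq]

theorem eqMulOneAddBigO_of_abs_sub_le {F M e : ℝ → ℝ} {A : ℝ} (hM : ∀ᶠ u in atTop, 0 < M u)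
    (h : ∀ᶠ u in atTop, |F u - M u| ≤ M u * (A * e u)) : EqMulOneAddBigO F M e := by
  refine ⟨fun u => F u / M u - 1, IsBigO.of_bound |A| ?_, ?_⟩
  · filter_upwards [hM, h] with u h1 h2
    rw [Real.norm_eq_abs, div_sub_one h1.ne', abs_div, abs_of_pos h1, div_le_iff₀' h1]
    refine h2.trans (mul_le_mul_of_nonneg_left ?_ h1.le)
    rw [Real.norm_eq_abs, ← abs_mul]
    exact le_abs_self _
  · filter_upwards [hM] with u h1
    field_simp
    ring

namespace UnitLevyDensity

variable {g : ℝ → ℝ} {S : Set ℝ} {M ε a : ℝ}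
  (h : UnitLevyDensity ((Ioo (0 : ℝ) 1).indicator g) S M ε a)
include h

theorem deriv_levyCumulant :
    deriv (levyCumulant g) = tiltedMoment (levyMeasure ((Ioo (0 : ℝ) 1).indicator g)) 1 := by
  have := h.isFiniteMeasure
  rw [h.levyCumulant_eq]
  exact funext fun θ => ((hasDerivAt_tiltedMoment h.ae_unit 0 θ).sub_const _).deriv

theorem saddleTerm_eq (β u : ℝ) : saddleTerm g β u =
    Real.exp (tiltedMoment (levyMeasure ((Ioo (0 : ℝ) 1).indicator g)) 0 β -
      tiltedMoment (levyMeasure ((Ioo (0 : ℝ) 1).indicator g)) 0 0 - u * β) /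
      (Real.sqrt (2 * Real.pi) *
        Real.sqrt (tiltedMoment (levyMeasure ((Ioo (0 : ℝ) 1).indicator g)) 2 β)) := by
  have := h.isFiniteMeasure
  rw [saddleTerm, tiltedSigma, iteratedDeriv_succ, iteratedDeriv_one, h.deriv_levyCumulant,
    (hasDerivAt_tiltedMoment h.ae_unit 1 β).deriv, h.levyCumulant_eq]

end UnitLevyDensity

/-! ### The main theorem. -/

theorem mainTheorem2 {Ω : Type*} [MeasurableSpace Ω] (P : Measure Ω) [IsProbabilityMeasure P]
    (T : Ω → ℝ) (hT : AEMeasurable T P)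
    (g : ℝ → ℝ) (hg_nonneg : ∀ x ∈ Icc (0 : ℝ) 1, 0 ≤ g x)
    (hg_smooth : PiecewiseContDiff 2 g 0 1)
    (ε : ℝ) (hε : 0 < ε) (hg_lower : ∀ x ∈ Icc (0 : ℝ) 1, 1 - ε ≤ x → ε ≤ g x)
    (hTg : HasLevyDensity T P g) :
    (∃ f : ℝ → ℝ, IsDefectiveDensity T P f) ∧
    (∀ u : ℝ, 0 < u → ∃! b : ℝ, deriv (levyCumulant g) b = u) ∧
    ∀ f : ℝ → ℝ, IsDefectiveDensity T P f →
    ∀ β : ℝ → ℝ, (∀ u : ℝ, 0 < u → deriv (levyCumulant g) (β u) = u) →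
      EqMulOneAddBigO f (fun u => saddleTerm g (β u) u) (fun u => 1 / u) ∧
      EqMulOneAddBigO (fun u => P.real {ω | u ≤ T ω})
        (fun u => 1 / β u * saddleTerm g (β u) u) (fun u => 1 / Real.sqrt u) ∧
      EqMulOneAddBigO (fun u => P.real {ω | u ≤ T ω})
        (fun u => f u / β u) (fun u => 1 / Real.sqrt u) := by
  obtain ⟨S, M, a, h⟩ := hg_smooth.unitLevyDensity hg_nonneg hε hg_lower
  have hfin := h.isFiniteMeasure
  have hμ := hTg.isCompoundPoisson hT h
  have hprob : IsProbabilityMeasure (P.map T) := Measure.isProbabilityMeasure_map hT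
  rw [h.deriv_levyCumulant]
  refine ⟨⟨UnitLevyDensity.density ((Ioo (0 : ℝ) 1).indicator g) (P.map T),
    h.measurable_density, h.density_nonneg, h.law_eq hμ, h.continuousOn_density hμ⟩,
    fun u hu => ?_, fun f hf β hβ => ?_⟩
  · obtain ⟨θ, hθ⟩ := h.exists_tiltedMoment_one_eq hu
    exact ⟨θ, hθ, fun θ' hθ' => h.strictMono_tiltedMoment_one.injective (hθ'.trans hθ.symm)⟩
  have hf' : IsOffAtomDensity (P.map T) f :=
    ⟨hf.measurable, hf.nonneg, hf.law_eq, hf.continuousOn⟩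
  obtain ⟨A, hA, hev⟩ := hf'.saddle_bounds h hμ
  have hβt : Tendsto β atTop atTop := by
    refine tendsto_atTop.2 fun b => ?_
    filter_upwards [eventually_gt_atTop 0, eventually_ge_atTop
      (tiltedMoment (levyMeasure ((Ioo (0 : ℝ) 1).indicator g)) 1 b)] with u hu hub
    rw [← hβ u hu] at hub
    exact h.strictMono_tiltedMoment_one.le_iff_le.1 hub
  have hP (u : ℝ) : P.real {ω | u ≤ T ω} = (P.map T).real (Ici u) := by
    rw [map_measureReal_apply_of_aemeasurable hT measurableSet_Ici]; rfl
  simp only [hP]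
  have key : ∀ᶠ u in atTop, 1 ≤ β u ∧ 0 < saddleTerm g (β u) u ∧
      |f u - saddleTerm g (β u) u| ≤ saddleTerm g (β u) u * (A / u) ∧
      |(P.map T).real (Ici u) - saddleTerm g (β u) u / β u| ≤
        saddleTerm g (β u) u / β u * (A / Real.sqrt u) := by
    filter_upwards [hβt.eventually hev, eventually_gt_atTop 0] with u h1 hu
    exact h1 u _ (hβ u hu).symm (h.saddleTerm_eq (β u) u)
  have hhalf : ∀ᶠ u : ℝ in atTop, 1 ≤ u ∧ 2 * A ≤ u :=
    (eventually_ge_atTop 1).and (eventually_ge_atTop _)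
  have hfpos : ∀ᶠ u in atTop, saddleTerm g (β u) u ≤ 2 * f u := by
    filter_upwards [key, hhalf] with u ⟨_, h2, h3, _⟩ ⟨hu1, hu⟩
    have : A / u ≤ 1 / 2 := by rw [div_le_div_iff₀ (by linarith) two_pos]; linarith
    nlinarith [(abs_le.1 h3).1, mul_le_mul_of_nonneg_left this h2.le]
  -- The last claim has `4A`: two errors `A/√u` relative to the saddle term, which is at most `2 f
  -- u`.
  refine ⟨eqMulOneAddBigO_of_abs_sub_le (A := A) (key.mono fun u hu => hu.2.1)
    (key.mono fun u hu => ?_), eqMulOneAddBigO_of_abs_sub_le (A := A)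
    (key.mono fun u hu => mul_pos (one_div_pos.2 (by linarith [hu.1])) hu.2.1)
    (key.mono fun u hu => ?_), eqMulOneAddBigO_of_abs_sub_le (A := 4 * A) ?_ ?_⟩
  · rw [mul_one_div]; exact hu.2.2.1
  · rw [mul_one_div, one_div_mul_eq_div]; exact hu.2.2.2
  · filter_upwards [key, hfpos] with u ⟨h1, h2, _, _⟩ h3
    exact div_pos (by linarith) (by linarith)
  · filter_upwards [key, hfpos, hhalf] with u ⟨h1, h2, h3, h4⟩ h5 ⟨hu1, _⟩
    have hβ0 : 0 < β u := by linarith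
    have hu0 : 0 < u := by linarith
    have hsq : 0 < Real.sqrt u := Real.sqrt_pos.2 hu0
    have hsu : A / u ≤ A / Real.sqrt u := by
      gcongr
      exact Real.sqrt_le_iff.2 ⟨hu0.le, by nlinarith⟩
    have h6 : |saddleTerm g (β u) u / β u - f u / β u| ≤
        saddleTerm g (β u) u / β u * (A / Real.sqrt u) := by
      rw [← sub_div, abs_div, abs_of_pos hβ0, div_mul_eq_mul_div, abs_sub_comm]
      gcongr
      exact h3.trans (by gcongr)
    calc _ ≤ _ := abs_sub_le _ (saddleTerm g (β u) u / β u) _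
      _ ≤ _ := add_le_add h4 h6
      _ = saddleTerm g (β u) u / β u * (2 * (A / Real.sqrt u)) := by ring
      _ ≤ 2 * f u / β u * (2 * (A / Real.sqrt u)) := by gcongr
      _ = _ := by ring
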